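/- Theorem. Let $X$ be a Polish space and let $G$ be a Borel graph on $X$, i.e. a simple graph with vertex set $X$ whose edge relation is a Borel subset of $X^2$. Let $\Delta(G)$ be the supremum of the degrees of the vertices of $G$ (a cardinal, not assumed finite). A Borel proper edge colouring of $G$ with $\kappa$ colours is a Borel assignment, to each edge, of a point of some standard Borel space of cardinality $\kappa$ (a discrete set of $\kappa$ colours if $\kappa$ is countable), such that distinct edges sharing a vertex receive distinct colours. The Borel edge chromatic number $\chi'_B(G)$ is the least cardinal $\kappa$ for which such a colouring exists; a set $C\subseteq X$ is $G$-invariant if it is a union of connected components of $G$; and the Baire measurable edge chromatic number $\chi'_{BM}(G)$ is the minimum of $\chi'_B(G\upharpoonright C)$ over all $G$-invariant comeagre Borel sets $C\subseteq X$, where $G\upharpoonright C$ is the induced graph on $C$. If $G$ is bipartite, then $$\chi'_{BM}(G)\le \Delta(G)+1 .$$ In particular, there is a $G$-invariant comeagre Borel set $C\subseteq X$ such that $G\upharpoonright C$ has a Borel proper edge colouring with $\Delta(G)+1$ colours. -/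

import Mathlib

open Cardinal Topology

namespace BorelGraph

universe u

/-- The edge relation of `G` is a Borel subset of the square of the vertex space. On a Polish
space the product of the Borel `σ`-algebras is the Borel `σ`-algebra of the product. -/
def IsBorel {X : Type u} [MeasurableSpace X] (G : SimpleGraph X) : Prop :=
  MeasurableSet {p : X × X | G.Adj p.1 p.2}

/-- The maximum degree of `G`, as a cardinal: the supremum of the degrees of its vertices. -/
noncomputable def maxDegree {X : Type u} (G : SimpleGraph X) : Cardinal.{u} :=
  ⨆ x : X, #(G.neighborSet x)

/-- A colouring of the edges of `G` (a function on unordered edges) is Borel if it is Borel as a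
function on the edge relation of `G`, a subset of the square of the vertex space. -/
def IsBorelColoring {X : Type u} [MeasurableSpace X] (G : SimpleGraph X)
    {Y : Type u} [MeasurableSpace Y] (c : G.edgeSet → Y) : Prop :=
  Measurable fun p : {p : X × X // G.Adj p.1 p.2} =>
    c ⟨s(p.1.1, p.1.2), G.mem_edgeSet.2 p.2⟩

/-- `G` has a Borel proper edge colouring with `κ` colours: the colours form a standard Borel
space of cardinality `κ` (when `κ` is countable this means a discrete set of `κ` colours), and
distinct edges which share a vertex, i.e. adjacent vertices of the line graph, get distinct
colours. -/
def HasBorelEdgeColoring {X : Type u} [MeasurableSpace X] (G : SimpleGraph X)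
    (κ : Cardinal.{u}) : Prop :=
  ∃ (Y : Type u) (_ : MeasurableSpace Y) (_ : StandardBorelSpace Y),
    #Y = κ ∧ ∃ c : G.lineGraph.Coloring Y, IsBorelColoring G c

/-- The Borel edge chromatic number of `G`. -/
noncomputable def borelEdgeChromaticNumber {X : Type u} [MeasurableSpace X]
    (G : SimpleGraph X) : Cardinal.{u} :=
  sInf {κ | HasBorelEdgeColoring G κ}

/-- `C` is a `G`-invariant comeagre Borel set. -/
structure IsInvariantComeagreBorel {X : Type u} [TopologicalSpace X] [MeasurableSpace X]
    (G : SimpleGraph X) (C : Set X) : Prop where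
  measurableSet : MeasurableSet C
  comeagre : C ∈ residual X
  invariant : ∀ x y : X, G.Adj x y → x ∈ C → y ∈ C

/-- The Baire measurable edge chromatic number of `G`: the minimum of the Borel edge chromatic
numbers of the induced graphs on the `G`-invariant comeagre Borel sets. -/
noncomputable def baireEdgeChromaticNumber {X : Type u} [TopologicalSpace X] [MeasurableSpace X]
    (G : SimpleGraph X) : Cardinal.{u} :=
  sInf {κ | ∃ C : Set X, IsInvariantComeagreBorel G C ∧
    borelEdgeChromaticNumber (G.induce C) = κ}

end BorelGraph

/-! The main case is that of a finite maximum degree `Δ`. The edges are exhausted by removing Borel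
matchings, each of which should lower the degree by one. In a bipartite graph with finite components
a matching covering all vertices of maximum degree exists (Hall), and it can be chosen in a Borel
way, since each component offers only countably many coded candidates; no Borel bipartition is
needed (`IsBorel.exists_matching_covering`). The difficulty is to reduce to finite components.

Off an invariant meagre set, the vertices are covered by very sparse Borel sets
(`IsBorel.exists_sparse_cover`). Around their points one builds finite pieces that are nested or far
apart, a toast. Let `B` be the union of the outer boundaries of the pieces, of width two. The edges
with an endpoint off `B` form finite components, because no path of such edges crosses a boundary;
the edges close to `B` form finite components as well, because boundaries of different pieces are
far apart.

The extra colour pays for the passage between the two regions. Let `Z j` be the `2 *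
j`-neighbourhood of `B`. After `j` matchings the degrees are at most `Δ + 1 - j`, and at most `Δ -
j` off `Z j`. The next matching joins one near `B`, covering the vertices of `Z j` of degree `Δ + 1
- j`, to one away from `B`, covering the vertices outside `Z (j + 1)` of degree `Δ - j`; the gap
keeps the two from sharing a vertex (`IsBorel.exists_matching_lowering_degree`). After `Δ` rounds
the degrees are at most one, so that what remains is the last of `Δ + 1` matchings.

If the degrees are countable with supremum `ℵ₀`, Luzin-Novikov uniformization splits the edges into
countably many Borel matchings. If some vertex has uncountably many neighbours, the maximum degree
is the size of the space and every edge can get its own colour. -/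

open MeasureTheory Set Filter

/-! ### Luzin-Novikov uniformization. -/

/-- An analytic set on which a continuous function is injective is contained in a Borel one. -/
theorem MeasureTheory.AnalyticSet.exists_measurableSet_injOn {Z X : Type*}
    [TopologicalSpace Z] [PolishSpace Z] [MeasurableSpace Z] [BorelSpace Z]
    [TopologicalSpace X] [T2Space X] [MeasurableSpace X] [BorelSpace X]
    {f : Z → X} (hf : Continuous f)
    {Q : Set Z} (hQ : AnalyticSet Q) (hinj : InjOn f Q) :
    ∃ Q', Q ⊆ Q' ∧ MeasurableSet Q' ∧ InjOn f Q' := by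
  obtain ⟨b, hbc, -, hb⟩ := TopologicalSpace.exists_countable_basis Z
  have hanal : ∀ s : Set Z, MeasurableSet s → AnalyticSet (f '' (Q ∩ s)) := by
    intro s hs
    have : Q ∩ s = ⋂ i : Bool, cond i Q s := by
      ext z; simp
      tauto
    rw [this]
    refine AnalyticSet.image_of_continuous (AnalyticSet.iInter ?_) hf
    rintro (_ | _)
    exacts [hs.analyticSet, hQ]
  have hsep : ∀ U : b, ∃ B : Set X, f '' (Q ∩ U) ⊆ B ∧ Disjoint (f '' (Q ∩ (U : Set Z)ᶜ)) B ∧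
      MeasurableSet B := by
    intro U
    have hU : MeasurableSet (U : Set Z) := (hb.isOpen U.2).measurableSet
    refine (hanal _ hU).measurablySeparable (hanal _ hU.compl) ?_
    rw [Set.disjoint_left]
    rintro _ ⟨z, ⟨hz, hzU⟩, rfl⟩ ⟨w, ⟨hw, hwU⟩, hwz⟩
    exact hwU (hinj hw hz hwz ▸ hzU)
  choose B hB1 hB2 hB3 using hsep
  have := hbc.to_subtype
  -- On this set `f z` decides which basic open sets contain `z`, and so determines `z`.
  refine ⟨⋂ U : b, {z | z ∈ (U : Set Z) ↔ f z ∈ B U}, ?_, ?_, ?_⟩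
  · intro z hz
    simp only [mem_iInter, mem_ofPred_eq]
    intro U
    refine ⟨fun h => hB1 U ⟨z, ⟨hz, h⟩, rfl⟩, fun h => ?_⟩
    by_contra hzU
    exact Set.disjoint_left.1 (hB2 U) ⟨z, ⟨hz, hzU⟩, rfl⟩ h
  · refine MeasurableSet.iInter fun U => ?_
    have h1 : MeasurableSet (U : Set Z) := (hb.isOpen U.2).measurableSet
    have h2 : MeasurableSet (f ⁻¹' (B U)) := hf.measurable (hB3 U)
    exact MeasurableSet.iff h1 h2
  · intro z hz w hw hzw
    simp only [mem_iInter, mem_ofPred_eq] at hz hw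
    by_contra hne
    obtain ⟨U, hU, hzU, hUs⟩ := hb.exists_subset_of_mem_open (show z ∈ ({w}ᶜ : Set Z) from hne)
      isOpen_compl_singleton
    have := (hw ⟨U, hU⟩).2 (hzw ▸ (hz ⟨U, hU⟩).1 hzU)
    exact hUs this rfl

/-- `S` is covered by countably many Borel sets on which `f` is injective. -/
def CountablyInjOn {Z X : Type*} [MeasurableSpace Z] (f : Z → X) (S : Set Z) : Prop :=
  ∃ A : ℕ → Set Z, (∀ n, MeasurableSet (A n) ∧ InjOn f (A n)) ∧ S ⊆ ⋃ n, A n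

theorem CountablyInjOn.iUnion {Z X : Type*} [MeasurableSpace Z] {f : Z → X} {ι : Type*} [Countable ι] {S : ι → Set Z}
    (h : ∀ i, CountablyInjOn f (S i)) : CountablyInjOn f (⋃ i, S i) := by
  choose A hA hAS using h
  cases isEmpty_or_nonempty ι
  · exact ⟨fun _ => ∅, fun _ => ⟨.empty, by simp⟩, by simp⟩
  obtain ⟨g, hg⟩ := exists_surjective_nat (ι × ℕ)
  refine ⟨fun n => A (g n).1 (g n).2, fun n => hA _ _, ?_⟩
  refine iUnion_subset fun i z hz => ?_
  obtain ⟨k, hk⟩ := mem_iUnion.1 (hAS i hz)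
  obtain ⟨n, hn⟩ := hg (i, k)
  exact mem_iUnion.2 ⟨n, by rw [hn]; exact hk⟩

theorem CountablyInjOn.exists_measurable {Z X : Type*} [MeasurableSpace Z] {f : Z → X}
    {S : Set Z} (h : CountablyInjOn f S) :
    ∃ T, S ⊆ T ∧ MeasurableSet T ∧ CountablyInjOn f T := by
  obtain ⟨A, hA, hS⟩ := h
  exact ⟨_, hS, .iUnion fun n => (hA n).1, A, hA, subset_rfl⟩

/-- Sequences whose first `k + 1` terms lie in one fibre of `f` and in the given sets. -/
def fiberTuples {Z X : Type*} (f : Z → X) (k : ℕ) (U : ℕ → Set Z) : Set (ℕ → Z) :=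
  {z | ∀ i ≤ k, z i ∈ U i ∧ f (z i) = f (z 0)}

/-- No countable union of Borel sets on which `f` is injective meets all the tuples. -/
def LargeTuples {Z X : Type*} [MeasurableSpace Z] (f : Z → X) (k : ℕ) (U : ℕ → Set Z) : Prop :=
  ∀ S, CountablyInjOn f S → ∃ z ∈ fiberTuples f k U, ∀ i ≤ k, z i ∉ S

/-- The splitting step of a Cantor scheme inside one fibre: coordinate `j` is doubled and all the
open sets shrink. If no choice of basic open sets worked, one set `T`, covered by countably many
Borel sets of injectivity, would meet every tuple with coordinate `j` doubled. Then `f` would be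
injective on the `j`th coordinates of the tuples avoiding `T`, and adding these coordinates to `T`
would contradict largeness. -/
theorem LargeTuples.split {Z X : Type*}
    [MetricSpace Z] [SecondCountableTopology Z] [CompleteSpace Z] [MeasurableSpace Z] [BorelSpace Z]
    [TopologicalSpace X] [T2Space X] [MeasurableSpace X] [BorelSpace X]
    {f : Z → X} (hf : Continuous f) {k : ℕ} {U : ℕ → Set Z} (hU : ∀ i ≤ k, IsOpen (U i))
    (h : LargeTuples f k U) {j : ℕ} (hj : j ≤ k) {ε : ℝ} (hε : 0 < ε) :
    ∃ U' : ℕ → Set Z, (∀ i ≤ k + 1, IsOpen (U' i)) ∧ LargeTuples f (k + 1) U' ∧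
      (∀ i ≤ k, closure (U' i) ⊆ U i) ∧ closure (U' (k + 1)) ⊆ U j ∧
      Disjoint (U' j) (U' (k + 1)) ∧ ∀ i ≤ k + 1, ∀ x ∈ U' i, ∀ y ∈ U' i, dist x y < ε := by
  by_contra hcon
  obtain ⟨b, hbc, -, hb⟩ := TopologicalSpace.exists_countable_basis Z
  have := hbc.to_subtype
  let V : (Fin (k + 2) → b) → ℕ → Set Z := fun t i => if h : i < k + 2 then t ⟨i, h⟩ else ∅
  have hVo : ∀ t i, IsOpen (V t i) := by
    intro t i
    simp only [V]
    split_ifs with hi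
    · exact hb.isOpen (t ⟨i, hi⟩).2
    · exact isOpen_empty
  have hS : ∀ t : Fin (k + 2) → b, ∃ S, CountablyInjOn f S ∧
      (((∀ i ≤ k, closure (V t i) ⊆ U i) ∧ closure (V t (k + 1)) ⊆ U j ∧
      Disjoint (V t j) (V t (k + 1)) ∧ ∀ i ≤ k + 1, ∀ x ∈ V t i, ∀ y ∈ V t i, dist x y < ε) →
      ∀ z ∈ fiberTuples f (k + 1) (V t), ∃ i ≤ k + 1, z i ∈ S) := by
    intro t
    by_cases ht : (∀ i ≤ k, closure (V t i) ⊆ U i) ∧ closure (V t (k + 1)) ⊆ U j ∧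
      Disjoint (V t j) (V t (k + 1)) ∧ ∀ i ≤ k + 1, ∀ x ∈ V t i, ∀ y ∈ V t i, dist x y < ε
    · have : ¬ LargeTuples f (k + 1) (V t) := fun hl => hcon ⟨V t, fun i _ => hVo t i, hl, ht⟩
      unfold LargeTuples at this
      push Not at this
      obtain ⟨S, hS, hS'⟩ := this
      exact ⟨S, hS, fun _ => hS'⟩
    · exact ⟨∅, ⟨fun _ => ∅, fun _ => ⟨.empty, by simp⟩, by simp⟩, fun h => absurd h ht⟩
  choose S hS1 hS2 using hS
  obtain ⟨T, hST, hTm, hT⟩ := (CountablyInjOn.iUnion hS1).exists_measurable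
  set J : Set (ℕ → Z) := {z | z ∈ fiberTuples f k U ∧ ∀ i ≤ k, z i ∉ T} with hJ
  have hJm : MeasurableSet J := by
    refine MeasurableSet.inter ?_ ?_
    · have : fiberTuples f k U = ⋂ i, ⋂ (_ : i ≤ k), ((fun z : ℕ → Z => z i) ⁻¹' U i ∩
          {z | f (z i) = f (z 0)}) := by
        ext z; simp [fiberTuples]
      rw [this]
      refine .iInter fun i => .iInter fun hi => .inter (measurable_pi_apply i (hU i hi).measurableSet)
        (IsClosed.measurableSet (isClosed_eq ?_ ?_)) <;> fun_prop
    · have : {z : ℕ → Z | ∀ i ≤ k, z i ∉ T} = ⋂ i, ⋂ (_ : i ≤ k), (fun z : ℕ → Z => z i) ⁻¹' Tᶜ := by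
        ext z; simp
      have h2 : MeasurableSet {z : ℕ → Z | ∀ i ≤ k, z i ∉ T} := by
        rw [this]
        exact .iInter fun i => .iInter fun hi => measurable_pi_apply i hTm.compl
      exact h2
  have hQ : AnalyticSet ((fun z : ℕ → Z => z j) '' J) :=
    hJm.analyticSet.image_of_continuous (continuous_apply j)
  obtain ⟨Q, hJQ, hQm, hQinj⟩ := hQ.exists_measurableSet_injOn hf (by
    rintro _ ⟨z, hz, rfl⟩ _ ⟨w, hw, rfl⟩ hzw
    by_contra hne
    replace hzw : f (z j) = f (w j) := hzw
    replace hne : z j ≠ w j := hne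
    -- The tuple `z` with `w j` appended lies in a single fibre and avoids `T`, whereas suitable
    -- basic sets around it force it to meet `T`.
    let y : ℕ → Z := fun i => if i = k + 1 then w j else z i
    obtain ⟨O₁, O₂, hO₁, hO₂, hz₁, hw₂, hdisj⟩ := t2_separation hne
    let O : ℕ → Set Z := fun i => (if i = k + 1 then U j ∩ O₂ else if i = j then U i ∩ O₁ else U i)
      ∩ Metric.ball (y i) (ε / 2)
    have hO : ∀ i ≤ k + 1, IsOpen (O i) ∧ y i ∈ O i := by
      intro i hi
      have hb : y i ∈ Metric.ball (y i) (ε / 2) := Metric.mem_ball_self (by positivity)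
      rcases eq_or_ne i (k + 1) with rfl | hik
      · have hyw : y (k + 1) = w j := by simp [y]
        simp only [O, if_true]
        exact ⟨((hU j hj).inter hO₂).inter Metric.isOpen_ball,
          ⟨⟨by rw [hyw]; exact (hw.1 j hj).1, by rw [hyw]; exact hw₂⟩, hb⟩⟩
      · have hyz : y i = z i := by simp [y, hik]
        have hik' : i ≤ k := by omega
        have := (hz.1 i hik').1
        simp only [O, if_neg hik]
        split_ifs with hij
        · subst hij
          exact ⟨((hU i hik').inter hO₁).inter Metric.isOpen_ball,
            ⟨⟨by rw [hyz]; exact this, by rw [hyz]; exact hz₁⟩, hb⟩⟩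
        · exact ⟨(hU i hik').inter Metric.isOpen_ball, ⟨by rw [hyz]; exact this, hb⟩⟩
    have hch : ∀ i : Fin (k + 2), ∃ B : b, y i ∈ (B : Set Z) ∧ closure (B : Set Z) ⊆ O i := by
      intro i
      obtain ⟨h1, h2⟩ := hO i (by omega)
      obtain ⟨B, hB, h3, h4⟩ := hb.exists_closure_subset (h1.mem_nhds h2)
      exact ⟨⟨B, hB⟩, h3, h4⟩
    choose t ht1 ht2 using hch
    have hVt : ∀ i (hi : i ≤ k + 1), y i ∈ V t i ∧ closure (V t i) ⊆ O i := by
      intro i hi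
      have hi' : i < k + 2 := by omega
      simp only [V, hi', dif_pos]
      exact ⟨ht1 ⟨i, hi'⟩, ht2 ⟨i, hi'⟩⟩
    have hjk : j ≠ k + 1 := by omega
    suffices hex : ∃ i ≤ k + 1, y i ∈ S t by
      obtain ⟨i, hi, hiS⟩ := hex
      have hiT : y i ∈ T := hST (mem_iUnion.2 ⟨t, hiS⟩)
      rcases eq_or_ne i (k + 1) with rfl | hik
      · exact hw.2 j hj (by simpa [y] using hiT)
      · exact hz.2 i (by omega) (by simpa [y, hik] using hiT)
    refine hS2 t ⟨?_, ?_, ?_, ?_⟩ y ?_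
    · intro i hi
      refine (hVt i (by omega)).2.trans ?_
      have hik : i ≠ k + 1 := by omega
      simp only [O, if_neg hik]
      split_ifs
      · exact fun x hx => hx.1.1
      · exact fun x hx => hx.1
    · refine (hVt _ le_rfl).2.trans ?_
      simp only [O, if_true]
      exact fun x hx => hx.1.1
    · refine hdisj.mono (subset_closure.trans ((hVt j (by omega)).2.trans ?_))
        (subset_closure.trans ((hVt _ le_rfl).2.trans ?_))
      · simp only [O, if_neg hjk, if_true]
        exact fun x hx => hx.1.2
      · simp only [O, if_true]
        exact fun x hx => hx.1.2
    · intro i hi p hp q hq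
      have h1 := ((hVt i hi).2 (subset_closure hp)).2
      have h2 := ((hVt i hi).2 (subset_closure hq)).2
      rw [Metric.mem_ball] at h1 h2
      rw [dist_comm] at h2
      linarith [dist_triangle p (y i) q]
    · intro i hi
      refine ⟨(hVt i hi).1, ?_⟩
      rcases eq_or_ne i (k + 1) with rfl | hik
      · simp only [y, if_true]
        rw [← hzw, (hz.1 j hj).2]
        simp
      · simp only [y, if_neg hik]
        rw [(hz.1 i (by omega)).2]
        simp)
  have hTQ : CountablyInjOn f (T ∪ Q) := by
    have : T ∪ Q = ⋃ i : Bool, cond i T Q := by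
      ext x; simp [or_comm]
    rw [this]
    refine CountablyInjOn.iUnion ?_
    rintro (_ | _)
    · exact ⟨fun _ => Q, fun _ => ⟨hQm, hQinj⟩, fun x hx => mem_iUnion.2 ⟨0, hx⟩⟩
    · exact hT
  obtain ⟨z, hz, hzS⟩ := h _ hTQ
  exact hzS j hj (Or.inr (hJQ ⟨z, ⟨hz, fun i hi hiT => hzS i hi (Or.inl hiT)⟩, rfl⟩))

/-- Luzin-Novikov uniformization for a continuous countable-to-one map. -/
theorem Continuous.countablyInjOn_univ {Z X : Type*}
    [TopologicalSpace Z] [PolishSpace Z] [MeasurableSpace Z] [BorelSpace Z]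
    [TopologicalSpace X] [T2Space X] [MeasurableSpace X] [BorelSpace X]
    {f : Z → X} (hf : Continuous f) (hc : ∀ x, (f ⁻¹' {x}).Countable) :
    CountablyInjOn f univ := by
  let := TopologicalSpace.upgradeIsCompletelyMetrizable Z
  by_contra hcon
  have h0 : LargeTuples f 0 (fun _ => univ) := by
    intro S hS
    by_contra h
    push Not at h
    refine hcon ?_
    obtain ⟨A, hA, hSA⟩ := hS
    refine ⟨A, hA, fun z _ => hSA ?_⟩
    obtain ⟨i, -, hi⟩ := h (fun _ => z) (by simp [fiberTuples])
    exact hi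
  -- Stage `k` doubles the coordinate `(Nat.unpair k).1`, so each coordinate is doubled infinitely
  -- often. The limit points then form a nonempty set without isolated points in one fibre, whose
  -- closure is perfect and hence uncountable.
  let State : ℕ → Type _ := fun k => {U : ℕ → Set Z // (∀ i ≤ k, IsOpen (U i)) ∧ LargeTuples f k U}
  have hstep : ∀ k (U : State k), ∃ U' : State (k + 1),
      (∀ i ≤ k, closure (U'.1 i) ⊆ U.1 i) ∧ closure (U'.1 (k + 1)) ⊆ U.1 (Nat.unpair k).1 ∧
      Disjoint (U'.1 (Nat.unpair k).1) (U'.1 (k + 1)) ∧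
      ∀ i ≤ k + 1, ∀ x ∈ U'.1 i, ∀ y ∈ U'.1 i, dist x y < (1 / 2 : ℝ) ^ k := by
    intro k U
    obtain ⟨U', h1, h2, h3⟩ := U.2.2.split hf U.2.1 (Nat.unpair_left_le k)
      (show (0 : ℝ) < (1 / 2 : ℝ) ^ k by positivity)
    exact ⟨⟨U', h1, h2⟩, h3⟩
  choose next hnext1 hnext2 hnext3 hnext4 using hstep
  let W : ∀ k, State k := fun k => Nat.rec ⟨fun _ => univ, fun _ _ => isOpen_univ, h0⟩ next k
  have hW : ∀ k, W (k + 1) = next k (W k) := fun k => rfl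
  have hmono : ∀ i k l, i ≤ k → k ≤ l → (W l).1 i ⊆ (W k).1 i := by
    intro i k l hik hkl
    induction l, hkl using Nat.le_induction with
    | base => exact subset_rfl
    | succ l hl ih =>
      rw [hW]
      exact subset_closure.trans ((hnext1 l (W l) i (hik.trans hl)).trans ih)
  have hne : ∀ k, ∃ z, z ∈ fiberTuples f k (W k).1 := by
    intro k
    obtain ⟨z, hz, -⟩ := (W k).2.2 ∅ ⟨fun _ => ∅, fun _ => ⟨.empty, by simp⟩, by simp⟩
    exact ⟨z, hz⟩
  choose p hp using hne
  have hpW : ∀ i k l, i ≤ k → k ≤ l → p l i ∈ (W k).1 i := fun i k l hik hkl =>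
    hmono i k l hik hkl (hp l i (hik.trans hkl)).1
  have hcau : ∀ i, ∃ z, Tendsto (fun k => p k i) atTop (𝓝 z) := by
    intro i
    apply cauchySeq_tendsto_of_complete
    rw [Metric.cauchySeq_iff]
    intro ε hε
    obtain ⟨n, hn⟩ := exists_pow_lt_of_lt_one hε (show (1 / 2 : ℝ) < 1 by norm_num)
    refine ⟨max n i + 1, fun a ha c hc => ?_⟩
    have := hnext4 (max n i) (W (max n i)) i (by omega) (p a i) (hpW i (max n i + 1) a (by omega) ha)
      (p c i) (hpW i (max n i + 1) c (by omega) hc)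
    refine this.trans (lt_of_le_of_lt ?_ hn)
    exact pow_le_pow_of_le_one (by norm_num) (by norm_num) (by omega)
  choose z hz using hcau
  have hzcl : ∀ i k, i ≤ k → z i ∈ closure ((W k).1 i) := fun i k hik =>
    mem_closure_of_tendsto (hz i) (eventually_atTop.2 ⟨k, fun l hl => hpW i k l hik hl⟩)
  have hzW : ∀ i k, i ≤ k → z i ∈ (W k).1 i := by
    intro i k hik
    have := hzcl i (k + 1) (by omega)
    rw [hW] at this
    exact hnext1 k (W k) i hik this
  have hfz : ∀ i, f (z i) = f (z 0) := by
    intro i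
    have h1 := (hf.tendsto (z i)).comp (hz i)
    have h2 := (hf.tendsto (z 0)).comp (hz 0)
    refine tendsto_nhds_unique (h1.congr' ?_) h2
    exact eventually_atTop.2 ⟨i, fun k hk => (hp k i hk).2⟩
  have hpre : Preperfect (range z) := by
    rw [preperfect_iff_nhds]
    rintro _ ⟨i, rfl⟩ O hO
    obtain ⟨ε, hε, hball⟩ := Metric.mem_nhds_iff.1 hO
    obtain ⟨n, hn⟩ := exists_pow_lt_of_lt_one hε (show (1 / 2 : ℝ) < 1 by norm_num)
    -- A late stage at which coordinate `i` is doubled. The sets of stage `k` have diameter at most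
    -- `(1 / 2) ^ (k - 1)`, whence `n + 1` in place of `n`.
    set k := Nat.pair i (n + 1) with hk
    obtain ⟨k', hk'⟩ : ∃ k', k = k' + 1 := by
      refine ⟨k - 1, ?_⟩
      have := Nat.right_le_pair i (n + 1)
      omega
    have hik : i ≤ k := Nat.left_le_pair i (n + 1)
    have hnk : n + 1 ≤ k := Nat.right_le_pair i (n + 1)
    have hun : (Nat.unpair k).1 = i := by rw [hk, Nat.unpair_pair]
    have h1 : z (k + 1) ∈ (W k).1 i := by
      have := hzcl (k + 1) (k + 1) le_rfl
      rw [hW] at this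
      have := hnext2 k (W k) this
      rwa [hun] at this
    refine ⟨z (k + 1), ⟨hball ?_, mem_range_self _⟩, ?_⟩
    · rw [Metric.mem_ball]
      have h2 := hzW i k hik
      rw [hk'] at h1 h2 ⊢
      rw [hW] at h1 h2
      refine (hnext4 k' (W k') i (by omega) _ h1 _ h2).trans (lt_of_le_of_lt ?_ hn)
      exact pow_le_pow_of_le_one (by norm_num) (by norm_num) (by omega)
    · intro heq
      have h2 := hzW (k + 1) (k + 1) le_rfl
      have h3 := hzW i (k + 1) (by omega)
      rw [heq] at h2
      rw [hW] at h2 h3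
      have := hnext3 k (W k)
      rw [hun] at this
      exact Set.disjoint_left.1 this h3 h2
  obtain ⟨g, hg, -, hginj⟩ := hpre.perfect_closure.exists_nat_bool_injection
    ((range_nonempty z).mono subset_closure)
  have hsub : closure (range z) ⊆ f ⁻¹' {f (z 0)} := by
    refine closure_minimal ?_ (IsClosed.preimage hf isClosed_singleton)
    rintro _ ⟨i, rfl⟩
    exact hfz i
  have hcount : (range g).Countable := (hc (f (z 0))).mono (hg.trans hsub)
  have : Countable (ℕ → Bool) := by
    rw [← Set.countable_univ_iff]
    refine MapsTo.countable_of_injOn (f := g) (fun a _ => mem_range_self a) hginj.injOn hcount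
  have h1 : #(ℕ → Bool) ≤ ℵ₀ := Cardinal.mk_le_aleph0
  simp only [mk_pi, mk_bool, Cardinal.prod_const, lift_id, mk_nat] at h1
  exact absurd (Cardinal.cantor ℵ₀) h1.not_gt

/-- Luzin-Novikov uniformization for a Borel countable-to-one map. -/
theorem Measurable.countablyInjOn_univ {Z X : Type*} [MeasurableSpace Z] [StandardBorelSpace Z]
    [MeasurableSpace X] [StandardBorelSpace X] {f : Z → X} (hf : Measurable f)
    (hc : ∀ x, (f ⁻¹' {x}).Countable) : CountablyInjOn f univ := by
  let := upgradeStandardBorel Z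
  let := upgradeStandardBorel X
  have hZ : PolishSpace Z := inferInstance
  -- A finer Polish topology with the same Borel sets makes `f` continuous.
  obtain ⟨t', ht', hft', hpol⟩ := hf.exists_continuous
  have hb : @BorelSpace Z t' _ := by
    refine @BorelSpace.mk _ t' _ ?_
    rw [eq_borel_upgradeStandardBorel Z, borel_eq_borel_of_le hpol hZ ht']
  exact @Continuous.countablyInjOn_univ Z X t' hpol _ hb _ _ _ _ f hft' hc

/-- A Borel relation with countable sections is a countable union of Borel partial functions. -/
theorem MeasurableSet.exists_iUnion_functional {X Y : Type*} [MeasurableSpace X]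
    [StandardBorelSpace X] [MeasurableSpace Y] [StandardBorelSpace Y] {P : Set (X × Y)}
    (hP : MeasurableSet P) (hc : ∀ x, {y | (x, y) ∈ P}.Countable) :
    ∃ Q : ℕ → Set (X × Y), (∀ n, MeasurableSet (Q n)) ∧
      (∀ n x y y', (x, y) ∈ Q n → (x, y') ∈ Q n → y = y') ∧ P = ⋃ n, Q n := by
  have := hP.standardBorel
  obtain ⟨A, hA, hcov⟩ := (measurable_fst.comp measurable_subtype_coe :
    Measurable fun p : P => p.1.1).countablyInjOn_univ (fun x => by
      have : MapsTo (fun p : P => p.1.2) ((fun p : P => p.1.1) ⁻¹' {x}) {y | (x, y) ∈ P} := by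
        rintro ⟨⟨a, b⟩, hp⟩ rfl
        exact hp
      refine MapsTo.countable_of_injOn this ?_ (hc x)
      rintro ⟨⟨a, b⟩, hp⟩ rfl ⟨⟨a', b'⟩, hp'⟩ h' hb
      simp_all)
  refine ⟨fun n => Subtype.val '' A n, fun n => hP.subtype_image (hA n).1, ?_, ?_⟩
  · rintro n x y y' ⟨p, hp, hpx⟩ ⟨q, hq, hqx⟩
    have := (hA n).2 hp hq (by simp [hpx, hqx])
    rw [this] at hpx
    exact congrArg Prod.snd (hpx.symm.trans hqx)
  · rw [← image_iUnion, univ_subset_iff.1 hcov, image_univ, Subtype.range_coe]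

/-! ### Borel structure of locally countable graphs. -/

namespace BorelGraph

variable {X : Type*} [MeasurableSpace X]

/-- Every vertex has at most one neighbour. -/
def IsMatchingGraph (M : SimpleGraph X) : Prop :=
  ∀ ⦃x y z⦄, M.Adj x y → M.Adj x z → y = z

theorem IsBorel.measurableSet_comp {G : SimpleGraph X} (hG : IsBorel G) {α : Type*}
    [MeasurableSpace α] {f g : α → X} (hf : Measurable f) (hg : Measurable g) :
    MeasurableSet {a | G.Adj (f a) (g a)} :=
  (hf.prodMk hg) hG

variable [StandardBorelSpace X]

/-- A locally countable Borel graph is a countable union of Borel matchings. -/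
theorem IsBorel.exists_matchings {G : SimpleGraph X} (hG : IsBorel G)
    (hc : ∀ x, (G.neighborSet x).Countable) :
    ∃ M : ℕ → SimpleGraph X, (∀ k, IsBorel (M k) ∧ IsMatchingGraph (M k)) ∧
      ∀ x y, G.Adj x y ↔ ∃ k, (M k).Adj x y := by
  obtain ⟨P, hPm, hPf, hP⟩ := hG.exists_iUnion_functional (fun x => hc x)
  obtain ⟨φ, hφ⟩ := exists_measurableEmbedding_real X
  -- The rational threshold fixes the side of each vertex: a vertex on the left has its neighbour
  -- determined by one partial function, a vertex on the right by the other, and no vertex plays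
  -- both roles.
  let A : ℕ × ℕ × ℚ → X → X → Prop := fun i x y =>
    φ x < i.2.2 ∧ i.2.2 < φ y ∧ (x, y) ∈ P i.1 ∧ (y, x) ∈ P i.2.1
  have hAm : ∀ i, MeasurableSet {p : X × X | A i p.1 p.2} := by
    intro i
    refine .inter ?_ (.inter ?_ (.inter ?_ ?_))
    · exact measurableSet_lt (hφ.measurable.comp measurable_fst) measurable_const
    · exact measurableSet_lt measurable_const (hφ.measurable.comp measurable_snd)
    · exact hPm _
    · exact measurable_swap (hPm _)
  let M : ℕ × ℕ × ℚ → SimpleGraph X := fun i =>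
    { Adj := fun x y => G.Adj x y ∧ (A i x y ∨ A i y x)
      symm := ⟨fun x y h => ⟨h.1.symm, h.2.symm⟩⟩
      loopless := ⟨fun x h => G.loopless.irrefl x h.1⟩ }
  have hM : ∀ i, IsBorel (M i) ∧ IsMatchingGraph (M i) := by
    intro i
    refine ⟨.inter hG (.union (hAm i) (measurable_swap (hAm i))), ?_⟩
    rintro x y z ⟨-, hy | hy⟩ ⟨-, hz | hz⟩
    · exact hPf _ _ _ _ hy.2.2.1 hz.2.2.1
    · exact absurd (hy.1.trans hz.2.1) (lt_irrefl _)
    · exact absurd (hz.1.trans hy.2.1) (lt_irrefl _)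
    · exact hPf _ _ _ _ hy.2.2.2 hz.2.2.2
  have hmem : ∀ x y, G.Adj x y → ∃ n, (x, y) ∈ P n := by
    intro x y h
    have : (x, y) ∈ ⋃ n, P n := hP ▸ h
    simpa using this
  have hcov : ∀ x y, G.Adj x y → ∃ i, (M i).Adj x y := by
    have key : ∀ x y, G.Adj x y → φ x < φ y → ∃ i, (M i).Adj x y := by
      intro x y h hlt
      obtain ⟨q, hq1, hq2⟩ := exists_rat_btwn hlt
      obtain ⟨n, hn⟩ := hmem x y h
      obtain ⟨m, hm⟩ := hmem y x h.symm
      exact ⟨(n, m, q), h, Or.inl ⟨hq1, hq2, hn, hm⟩⟩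
    intro x y h
    rcases lt_trichotomy (φ x) (φ y) with hlt | heq | hlt
    · exact key x y h hlt
    · exact absurd (hφ.injective heq) h.ne
    · obtain ⟨i, hi⟩ := key y x h.symm hlt
      exact ⟨i, hi.symm⟩
  obtain ⟨e, he⟩ := exists_surjective_nat (ℕ × ℕ × ℚ)
  refine ⟨fun k => M (e k), fun k => hM _, fun x y => ⟨fun h => ?_, fun ⟨k, hk⟩ => hk.1⟩⟩
  obtain ⟨i, hi⟩ := hcov x y h
  obtain ⟨k, rfl⟩ := he i
  exact ⟨k, hi⟩

/-- The partner in a Borel matching, or the vertex itself when unmatched, is a Borel function. -/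
theorem IsBorel.exists_partner {M : SimpleGraph X} (hM : IsBorel M) (hm : IsMatchingGraph M) :
    ∃ T : X → X, Measurable T ∧ (∀ x, T x = x ∨ M.Adj x (T x)) ∧ ∀ x y, M.Adj x y → T x = y := by
  classical
  let T : X → X := fun x => if h : ∃ y, M.Adj x y then h.choose else x
  have hT : ∀ x y, M.Adj x y → T x = y := by
    intro x y h
    have hex : ∃ y, M.Adj x y := ⟨y, h⟩
    simp only [T, hex, dif_pos]
    exact hm hex.choose_spec h
  have himg : ∀ A : Set X, MeasurableSet A →
      MeasurableSet (Prod.fst '' ({p : X × X | M.Adj p.1 p.2} ∩ Prod.snd ⁻¹' A)) := by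
    intro A hA
    -- The first projection is injective on the edges of a matching, so the image is Borel by
    -- Luzin-Souslin.
    refine (MeasurableSet.inter hM (measurable_snd hA)).image_of_measurable_injOn measurable_fst ?_
    rintro ⟨x, y⟩ ⟨h, -⟩ ⟨x', y'⟩ ⟨h', -⟩ (rfl : x = x')
    exact Prod.ext rfl (hm h h')
  refine ⟨T, ?_, ?_, hT⟩
  · intro A hA
    have : T ⁻¹' A = (Prod.fst '' ({p : X × X | M.Adj p.1 p.2} ∩ Prod.snd ⁻¹' A)) ∪
        (A \ (Prod.fst '' ({p : X × X | M.Adj p.1 p.2} ∩ Prod.snd ⁻¹' univ))) := by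
      ext x
      by_cases hx : ∃ y, M.Adj x y
      · obtain ⟨y, hy⟩ := hx
        have h1 : ∀ y', M.Adj x y' ↔ y' = y := fun y' => ⟨fun h => hm h hy, fun h => h ▸ hy⟩
        simp [hT x y hy, h1]
      · have h1 : ∀ y', ¬ M.Adj x y' := fun y' h => hx ⟨y', h⟩
        simp [T, h1]
    rw [this]
    exact (himg A hA).union (hA.diff (himg univ .univ))
  · intro x
    by_cases hx : ∃ y, M.Adj x y
    · right
      obtain ⟨y, hy⟩ := hx
      rwa [hT x y hy]
    · left
      simp [T, hx]

/-- The edges at the vertices of a locally countable Borel graph are enumerated by Borel maps. -/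
theorem IsBorel.exists_neighbor_enum {G : SimpleGraph X} (hG : IsBorel G)
    (hc : ∀ x, (G.neighborSet x).Countable) :
    ∃ T : ℕ → X → X, (∀ k, Measurable (T k)) ∧ (∀ k x, T k x = x ∨ G.Adj x (T k x)) ∧
      ∀ x y, G.Adj x y → ∃ k, T k x = y := by
  obtain ⟨M, hM, hGM⟩ := hG.exists_matchings hc
  choose T hT1 hT2 hT3 using fun k => (hM k).1.exists_partner (hM k).2
  refine ⟨T, hT1, fun k x => (hT2 k x).imp_right fun h => (hGM _ _).2 ⟨k, h⟩, fun x y h => ?_⟩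
  obtain ⟨k, hk⟩ := (hGM x y).1 h
  exact ⟨k, hT3 k x y hk⟩

/-- The components of a locally countable Borel graph are enumerated by Borel maps. -/
theorem IsBorel.exists_reachable_enum {G : SimpleGraph X} (hG : IsBorel G)
    (hc : ∀ x, (G.neighborSet x).Countable) :
    ∃ a : ℕ → X → X, (∀ k, Measurable (a k)) ∧ ∀ x y, G.Reachable x y ↔ ∃ k, a k x = y := by
  obtain ⟨T, hT1, hT2, hT3⟩ := hG.exists_neighbor_enum hc
  let act : List ℕ → X → X := fun w x => w.foldr (fun k z => T k z) x
  have hmeas : ∀ w, Measurable (act w) := by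
    intro w
    induction w with
    | nil => exact measurable_id
    | cons k w ih => exact (hT1 k).comp ih
  have hreach : ∀ w x, G.Reachable x (act w x) := by
    intro w x
    induction w with
    | nil => exact .refl _
    | cons k w ih =>
      rcases hT2 k (act w x) with h | h
      · show G.Reachable x (T k (act w x))
        rwa [h]
      · exact ih.trans h.reachable
  obtain ⟨e, he⟩ := exists_surjective_nat (List ℕ)
  refine ⟨fun k => act (e k), fun k => hmeas _, fun x y => ⟨fun h => ?_, ?_⟩⟩
  · suffices ∃ w, act w x = y by
      obtain ⟨w, hw⟩ := this
      obtain ⟨k, rfl⟩ := he w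
      exact ⟨k, hw⟩
    rw [SimpleGraph.reachable_iff_reflTransGen] at h
    induction h with
    | refl => exact ⟨[], rfl⟩
    | tail _ hbc ih =>
      obtain ⟨w, rfl⟩ := ih
      obtain ⟨k, hk⟩ := hT3 _ _ hbc
      exact ⟨k :: w, hk⟩
  · rintro ⟨k, rfl⟩
    exact hreach _ _

/-- Quantification over the components of a locally countable Borel graph preserves Borel sets. -/
theorem IsBorel.measurableSet_exists {G : SimpleGraph X} (hG : IsBorel G)
    (hc : ∀ x, (G.neighborSet x).Countable) {α : Type*} [MeasurableSpace α] {g : α → X}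
    (hg : Measurable g) {Q : α → X → Prop} (hQ : MeasurableSet {q : α × X | Q q.1 q.2})
    (hQr : ∀ p y, Q p y → G.Reachable (g p) y) : MeasurableSet {p | ∃ y, Q p y} := by
  obtain ⟨a, ha, hr⟩ := hG.exists_reachable_enum hc
  have : {p | ∃ y, Q p y} = ⋃ k, {p | Q p (a k (g p))} := by
    ext p
    simp only [mem_ofPred_eq, mem_iUnion]
    constructor
    · rintro ⟨y, hy⟩
      obtain ⟨k, rfl⟩ := (hr _ _).1 (hQr p y hy)
      exact ⟨k, hy⟩
    · rintro ⟨k, hk⟩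
      exact ⟨_, hk⟩
  rw [this]
  exact .iUnion fun k => (measurable_id.prodMk ((ha k).comp hg)) hQ

theorem IsBorel.measurableSet_reachable {G : SimpleGraph X} (hG : IsBorel G)
    (hc : ∀ x, (G.neighborSet x).Countable) :
    MeasurableSet {p : X × X | G.Reachable p.1 p.2} := by
  obtain ⟨a, ha, hr⟩ := hG.exists_reachable_enum hc
  have : {p : X × X | G.Reachable p.1 p.2} = ⋃ k, {p | a k p.1 = p.2} := by
    ext p
    simp [hr]
  rw [this]
  exact .iUnion fun k => measurableSet_eq_fun ((ha k).comp measurable_fst) measurable_snd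

theorem IsBorel.measurableSet_forall {G : SimpleGraph X} (hG : IsBorel G)
    (hc : ∀ x, (G.neighborSet x).Countable) {α : Type*} [MeasurableSpace α] {g : α → X}
    (hg : Measurable g) {Q : α → X → Prop} (hQ : MeasurableSet {q : α × X | Q q.1 q.2}) :
    MeasurableSet {p | ∀ y, G.Reachable (g p) y → Q p y} := by
  have := hG.measurableSet_exists hc hg (Q := fun p y => G.Reachable (g p) y ∧ ¬ Q p y)
    (.inter (((hg.comp measurable_fst).prodMk measurable_snd) (hG.measurableSet_reachable hc))
      hQ.compl) (fun p y h => h.1)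
  convert! this.compl using 1
  ext p
  simp

/-- A Borel relation with finite sections inside the components admits a Borel labelling of the
vertices by natural numbers which separates distinct related vertices. -/
theorem IsBorel.exists_labelling {G : SimpleGraph X} (hG : IsBorel G)
    (hc : ∀ x, (G.neighborSet x).Countable) {R : X → X → Prop}
    (hR : MeasurableSet {p : X × X | R p.1 p.2}) (hRr : ∀ x y, R x y → G.Reachable x y)
    (hfin : ∀ x, {y | R x y}.Finite) :
    ∃ N : X → ℕ, Measurable N ∧ ∀ x y, R x y → N x = N y → x = y := by
  classical
  let := upgradeStandardBorel X
  obtain ⟨b, hbc, -, hb⟩ := TopologicalSpace.exists_countable_basis X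
  let U : ℕ → Set X := enumerateCountable hbc ∅
  have hUo : ∀ k, MeasurableSet (U k) := by
    intro k
    rcases range_enumerateCountable_subset hbc ∅ (mem_range_self k) with h | h
    · simp only [U, h, MeasurableSet.empty]
    · exact (hb.isOpen h).measurableSet
  -- The label of `x` is the least index of a basic open set isolating `x` from the other vertices
  -- related to it; a finite set can always be excluded.
  let p : X → ℕ → Prop := fun x k => x ∈ U k ∧ ∀ y, G.Reachable x y → R x y → y ∈ U k → x = y
  have hp : ∀ x, ∃ k, p x k := by
    intro x
    have hcl : IsOpen ({y | R x y} \ {x})ᶜ := ((hfin x).subset sdiff_subset).isClosed.isOpen_compl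
    obtain ⟨V, hV, hxV, hVs⟩ := hb.exists_subset_of_mem_open (show x ∈ ({y | R x y} \ {x})ᶜ by simp)
      hcl
    obtain ⟨k, rfl⟩ := subset_range_enumerate hbc ∅ hV
    refine ⟨k, hxV, fun y _ hy hyU => ?_⟩
    by_contra hne
    exact hVs hyU ⟨hy, fun h => hne h.symm⟩
  have hpm : ∀ k, MeasurableSet {x | p x k} := by
    intro k
    refine (hUo k).inter (hG.measurableSet_forall hc measurable_id
      (Q := fun x y => R x y → y ∈ U k → x = y) ?_)
    exact hR.imp ((measurable_snd (hUo k)).imp (measurableSet_eq_fun measurable_fst measurable_snd))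
  refine ⟨fun x => Nat.find (hp x), measurable_find hp hpm, fun x y hxy hN => ?_⟩
  have h1 := Nat.find_spec (hp x)
  have h2 := Nat.find_spec (hp y)
  have hN' : Nat.find (hp x) = Nat.find (hp y) := hN
  rw [← hN'] at h2
  exact h1.2 y (hRr x y hxy) hxy h2.1

end BorelGraph

/-! ### Matchings covering the vertices of maximum degree, with finite components. -/

namespace BorelGraph

/-- In a finite graph of maximum degree at most `D`, some permutation moves each vertex to itself
or to a neighbour, and moves every vertex of degree `D`. -/
theorem exists_perm_adj_of_degree_le {K : Type*} [Fintype K] [DecidableEq K] (H : SimpleGraph K)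
    [DecidableRel H.Adj] {D : ℕ} (hD : 0 < D) (hdeg : ∀ v, H.degree v ≤ D) :
    ∃ σ : Equiv.Perm K, ∀ v, (σ v = v ∨ H.Adj v (σ v)) ∧ (H.degree v = D → H.Adj v (σ v)) := by
  -- Weighted loops make every row and column sum equal to `D`, so double counting gives Hall's
  -- condition. A vertex of degree `D` gets no loop and must move.
  let A : Matrix K K ℕ := fun v w => (if H.Adj v w then 1 else 0) +
    if v = w then D - H.degree v else 0
  have hrow : ∀ v, ∑ w, A v w = D := by
    intro v
    simp only [A, Finset.sum_add_distrib, Finset.sum_ite_eq, Finset.mem_univ, if_true]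
    rw [← Finset.sum_filter, Finset.sum_const, smul_eq_mul, mul_one, ← H.neighborFinset_eq_filter,
      H.card_neighborFinset_eq_degree]
    have := hdeg v
    omega
  have hsymm : ∀ v w, A v w = A w v := by
    intro v w
    simp only [A, H.adj_comm v w, eq_comm (a := v) (b := w)]
    congr 1
    split_ifs with h
    · rw [h]
    · rfl
  let f : K → Finset K := fun v => {w | A v w ≠ 0}
  have hall : ∀ s : Finset K, s.card ≤ (s.biUnion f).card := by
    intro s
    have h1 : ∑ v ∈ s, ∑ w ∈ f v, A v w = s.card * D := by
      rw [Finset.sum_congr rfl (g := fun _ => D), Finset.sum_const, smul_eq_mul]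
      intro v _
      rw [← hrow v]
      exact Finset.sum_subset (Finset.filter_subset _ _) (by simp [f])
    have h2 : ∑ w ∈ s.biUnion f, ∑ v, A v w = (s.biUnion f).card * D := by
      rw [Finset.sum_congr rfl (g := fun _ => D), Finset.sum_const, smul_eq_mul]
      intro w _
      rw [← hrow w]
      exact Finset.sum_congr rfl fun v _ => hsymm v w
    refine Nat.le_of_mul_le_mul_right ?_ hD
    rw [← h1, ← h2, Finset.sum_comm]
    calc ∑ v ∈ s, ∑ w ∈ f v, A v w ≤ ∑ v ∈ s, ∑ w ∈ s.biUnion f, A v w :=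
          Finset.sum_le_sum fun v hv => Finset.sum_le_sum_of_subset (Finset.subset_biUnion_of_mem f hv)
      _ ≤ _ := Finset.sum_le_sum_of_subset (Finset.subset_univ s)
  obtain ⟨g, hg, hgf⟩ := (Finset.all_card_le_biUnion_card_iff_exists_injective f).1 hall
  refine ⟨Equiv.ofBijective g (Finite.injective_iff_bijective.1 hg), fun v => ?_⟩
  have hv : A v (g v) ≠ 0 := by simpa [f] using hgf v
  simp only [A] at hv
  simp only [Equiv.ofBijective_apply]
  by_cases hadj : H.Adj v (g v)
  · exact ⟨Or.inr hadj, fun _ => hadj⟩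
  · rw [if_neg hadj, zero_add] at hv
    split_ifs at hv with h
    · exact ⟨Or.inl h.symm, fun h' => by omega⟩
    · exact absurd rfl hv

/-- The matching inside a component: a bipartite graph of maximum degree at most `D` has, near
any vertex whose component is finite, a matching covering the vertices of degree `D`. -/
theorem exists_matching_on_component {X : Type*} {H : SimpleGraph X} (hbip : H.IsBipartite)
    {D : ℕ} (hD : 0 < D) (hdeg : ∀ x, (H.neighborSet x).ncard ≤ D) (x : X)
    (hfin : {y | H.Reachable x y}.Finite) :
    ∃ m : X → X → Prop, (∀ y z, m y z → H.Adj y z) ∧ (∀ y z, m y z → m z y) ∧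
      (∀ y z z', m y z → m y z' → z = z') ∧
      ∀ y, H.Reachable x y → (H.neighborSet y).ncard = D → ∃ z, m y z := by
  classical
  obtain ⟨c⟩ := hbip
  set K := {y | H.Reachable x y} with hK
  have := hfin.fintype
  have hd : ∀ v : K, (H.induce K).degree v = (H.neighborSet v).ncard := by
    intro v
    rw [← SimpleGraph.card_neighborFinset_eq_degree, ← Set.ncard_coe_finset,
      SimpleGraph.coe_neighborFinset]
    refine (Set.ncard_image_of_injective _ Subtype.val_injective).symm.trans ?_
    congr 1
    ext w
    simp only [mem_image, SimpleGraph.mem_neighborSet, SimpleGraph.comap_adj,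
      Function.Embedding.subtype_apply]
    constructor
    · rintro ⟨u, hu, rfl⟩
      exact hu
    · intro hw
      exact ⟨⟨w, v.2.trans hw.reachable⟩, hw, rfl⟩
  obtain ⟨σ', hσ'⟩ := exists_perm_adj_of_degree_le (H.induce K) hD (fun v => (hd v).trans_le (hdeg v))
  let σ : Equiv.Perm X := Equiv.Perm.ofSubtype σ'
  have hσ : ∀ v, σ v = v ∨ H.Adj v (σ v) := by
    intro v
    by_cases hv : v ∈ K
    · simp only [σ, Equiv.Perm.ofSubtype_apply_of_mem σ' hv]
      exact (hσ' ⟨v, hv⟩).1.imp (fun h => congrArg Subtype.val h) id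
    · exact Or.inl (Equiv.Perm.ofSubtype_apply_of_not_mem σ' hv)
  have hσD : ∀ v, H.Reachable x v → (H.neighborSet v).ncard = D → H.Adj v (σ v) := by
    intro v hv hvD
    simp only [σ, Equiv.Perm.ofSubtype_apply_of_mem σ' hv]
    exact (hσ' ⟨v, hv⟩).2 ((hd ⟨v, hv⟩).trans hvD)
  have hc : ∀ y z, H.Adj y z → c y = 0 → c z ≠ 0 := fun y z h hy hz => c.valid h (hy.trans hz.symm)
  -- The matching consists of the edges from `v` to `σ v` with `v` in the class of colour `0`.
  -- Vertices of degree `D` in that class are covered through `σ`, those in the other class through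
  -- its inverse.
  refine ⟨fun y z => H.Adj y z ∧ ((c y = 0 ∧ σ y = z) ∨ (c z = 0 ∧ σ z = y)), fun y z h => h.1,
    fun y z h => ⟨h.1.symm, h.2.symm⟩, ?_, ?_⟩
  · rintro y z z' ⟨h, ⟨hy, hz⟩ | ⟨hy, hz⟩⟩ ⟨h', ⟨hy', hz'⟩ | ⟨hy', hz'⟩⟩
    · exact hz.symm.trans hz'
    · exact absurd hy (hc _ _ h'.symm hy')
    · exact absurd hy' (hc _ _ h.symm hy)
    · exact σ.injective (hz.trans hz'.symm)
  · intro y hy hyD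
    have h1 := hσD y hy hyD
    by_cases hy0 : c y = 0
    · exact ⟨σ y, h1, Or.inl ⟨hy0, rfl⟩⟩
    · have h2 : σ (σ.symm y) = y := σ.apply_symm_apply y
      have h3 : H.Adj (σ.symm y) y := by
        rcases hσ (σ.symm y) with h | h
        · rw [h2] at h
          rw [← h] at h2
          exact absurd h2 h1.ne'
        · rwa [h2] at h
      have hbool : ∀ i j : Fin 2, i ≠ 0 → i ≠ j → j = 0 := by decide
      exact ⟨σ.symm y, h3.symm, Or.inr ⟨hbool _ _ hy0 (c.valid h3.symm), h2⟩⟩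

variable {X : Type*} [MeasurableSpace X] [StandardBorelSpace X]

theorem IsBorel.measurableSet_le_ncard_neighborSet {G : SimpleGraph X} (hG : IsBorel G)
    (hf : ∀ x, (G.neighborSet x).Finite) (D : ℕ) :
    MeasurableSet {x | D ≤ (G.neighborSet x).ncard} := by
  obtain ⟨T, hT, -, hTG⟩ := hG.exists_neighbor_enum (fun x => (hf x).countable)
  -- The degree is at least `D` exactly when `D` of the enumerating maps give distinct neighbours.
  have : {x | D ≤ (G.neighborSet x).ncard} = ⋃ t : Fin D → ℕ,
      ((⋂ i, {x | G.Adj x (T (t i) x)}) ∩ ⋂ i, ⋂ j, {x | T (t i) x = T (t j) x → i = j}) := by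
    ext x
    simp only [mem_ofPred_eq, mem_iUnion, mem_inter_iff, mem_iInter]
    have := (hf x).to_subtype
    have hcard : Nat.card (Fin D) = D := by simp
    constructor
    · intro h
      have := (hf x).fintype
      have h2 : Fintype.card (Fin D) ≤ Fintype.card (G.neighborSet x) := by
        rwa [Fintype.card_fin, ← Nat.card_eq_fintype_card]
      obtain ⟨e⟩ := Function.Embedding.nonempty_of_card_le h2
      choose t ht using fun i => hTG x (e i) (e i).2
      refine ⟨t, fun i => ?_, fun i j hij => ?_⟩
      · rw [ht]
        exact (e i).2
      · rw [ht, ht] at hij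
        exact e.injective (Subtype.ext hij)
    · rintro ⟨t, h1, h2⟩
      have := Nat.card_le_card_of_injective (fun i : Fin D => (⟨T (t i) x, h1 i⟩ : G.neighborSet x))
        (fun i j hij => h2 i j (congrArg Subtype.val hij))
      rwa [hcard] at this
  rw [this]
  refine .iUnion fun t => .inter (.iInter fun i => ?_) (.iInter fun i => .iInter fun j => ?_)
  · exact hG.measurableSet_comp measurable_id (hT _)
  · exact (measurableSet_eq_fun (hT _) (hT _)).imp (.const _)

/-- A Borel bipartite graph with finite components and maximum degree at most `D` has a Borel
matching which covers all the vertices of degree `D`. -/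
theorem IsBorel.exists_matching_covering {H : SimpleGraph X} (hH : IsBorel H)
    (hbip : H.IsBipartite) (hfin : ∀ x, {y | H.Reachable x y}.Finite) {D : ℕ} (hD : 0 < D)
    (hdeg : ∀ x, (H.neighborSet x).ncard ≤ D) :
    ∃ M ≤ H, IsBorel M ∧ IsMatchingGraph M ∧
      ∀ x, (H.neighborSet x).ncard = D → ∃ y, M.Adj x y := by
  classical
  have hf : ∀ x, (H.neighborSet x).Finite := fun x =>
    (hfin x).subset fun y hy => SimpleGraph.Adj.reachable hy
  have hc : ∀ x, (H.neighborSet x).Countable := fun x => (hf x).countable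
  have hRm := hH.measurableSet_reachable hc
  obtain ⟨N, hN, hNinj⟩ := hH.exists_labelling hc hRm (fun x y h => h) hfin
  let W : Set X := {x | (H.neighborSet x).ncard = D}
  have hW : MeasurableSet W := by
    have : W = {x | D ≤ (H.neighborSet x).ncard} ∩ {x | D + 1 ≤ (H.neighborSet x).ncard}ᶜ := by
      ext x
      simp only [W, mem_ofPred_eq, mem_inter_iff, mem_compl_iff]
      omega
    rw [this]
    exact (hH.measurableSet_le_ncard_neighborSet hf _).inter
      (hH.measurableSet_le_ncard_neighborSet hf _).compl
  -- Labels are injective on components, so a matching of a finite component is coded by a finite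
  -- set of pairs of labels. There are countably many codes, and each component uses its first good
  -- one.
  let L : Finset (ℕ × ℕ) → X → X → Prop := fun q y z => H.Adj y z ∧ (N y, N z) ∈ q
  have hL : ∀ q {α : Type _} [MeasurableSpace α] {f g : α → X}, Measurable f → Measurable g →
      MeasurableSet {a | L q (f a) (g a)} := by
    intro q α _ f g hf hg
    exact (hH.measurableSet_comp hf hg).inter
      (((hN.comp hf).prodMk (hN.comp hg)) (Set.to_countable (q : Set (ℕ × ℕ))).measurableSet)
  let good : X → Finset (ℕ × ℕ) → Prop := fun x q =>
    ∀ y, H.Reachable x y → (∀ z, H.Reachable y z → L q y z → L q z y) ∧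
      (∀ z, H.Reachable y z → ∀ z', H.Reachable y z' → L q y z → L q y z' → z = z') ∧
      (y ∈ W → ∃ z, L q y z)
  have hgood : ∀ q, MeasurableSet {x | good x q} := by
    intro q
    refine hH.measurableSet_forall hc measurable_id (Q := fun _ y =>
      (∀ z, H.Reachable y z → L q y z → L q z y) ∧
      (∀ z, H.Reachable y z → ∀ z', H.Reachable y z' → L q y z → L q y z' → z = z') ∧
      (y ∈ W → ∃ z, L q y z)) ?_
    suffices h : MeasurableSet {y : X | (∀ z, H.Reachable y z → L q y z → L q z y) ∧
      (∀ z, H.Reachable y z → ∀ z', H.Reachable y z' → L q y z → L q y z' → z = z') ∧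
      (y ∈ W → ∃ z, L q y z)} from measurable_snd h
    refine .inter ?_ (.inter ?_ ?_)
    · refine hH.measurableSet_forall hc measurable_id (Q := fun y z => L q y z → L q z y) ?_
      exact (hL q measurable_fst measurable_snd).imp (hL q measurable_snd measurable_fst)
    · refine hH.measurableSet_forall hc measurable_id
        (Q := fun y z => ∀ z', H.Reachable y z' → L q y z → L q y z' → z = z') ?_
      refine hH.measurableSet_forall hc measurable_fst
        (Q := fun (p : X × X) z' => L q p.1 p.2 → L q p.1 z' → p.2 = z') ?_
      have h1 : Measurable fun p : (X × X) × X => p.1.1 := measurable_fst.comp measurable_fst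
      have h2 : Measurable fun p : (X × X) × X => p.1.2 := measurable_snd.comp measurable_fst
      exact (hL q h1 h2).imp ((hL q h1 measurable_snd).imp (measurableSet_eq_fun h2 measurable_snd))
    · refine hW.imp (hH.measurableSet_exists hc measurable_id (Q := fun y z => L q y z)
        (hL q measurable_fst measurable_snd) fun y z h => h.1.reachable)
  have hex : ∀ x, ∃ q, good x q := by
    intro x
    obtain ⟨m, hm1, hm2, hm3, hm4⟩ := exists_matching_on_component hbip hD hdeg x (hfin x)
    have hfin2 : ({y | H.Reachable x y} ×ˢ {y | H.Reachable x y}).Finite := (hfin x).prod (hfin x)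
    let q : Finset (ℕ × ℕ) := (hfin2.toFinset.filter fun p => m p.1 p.2).image (Prod.map N N)
    have hq : ∀ y z, H.Reachable x y → H.Reachable x z → (L q y z ↔ m y z) := by
      intro y z hy hz
      constructor
      · rintro ⟨hyz, h⟩
        simp only [q, Finset.mem_image, Finset.mem_filter, Finite.mem_toFinset, Prod.exists,
          Prod.map_apply, Prod.mk.injEq, mem_prod, mem_ofPred_eq] at h
        obtain ⟨y', z', ⟨⟨hy', hz'⟩, hm⟩, h1, h2⟩ := h
        rw [← hNinj y' y (hy'.symm.trans hy) h1, ← hNinj z' z (hz'.symm.trans hz) h2]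
        exact hm
      · intro h
        refine ⟨hm1 _ _ h, ?_⟩
        simp only [q, Finset.mem_image, Finset.mem_filter, Finite.mem_toFinset, Prod.exists,
          Prod.map_apply, Prod.mk.injEq, mem_prod, mem_ofPred_eq]
        exact ⟨y, z, ⟨⟨hy, hz⟩, h⟩, rfl, rfl⟩
    refine ⟨q, fun y hy => ⟨fun z hz h => ?_, fun z hz z' hz' h h' => ?_, fun hyW => ?_⟩⟩
    · rw [hq _ _ hy (hy.trans hz)] at h
      rw [hq _ _ (hy.trans hz) hy]
      exact hm2 _ _ h
    · rw [hq _ _ hy (hy.trans hz)] at h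
      rw [hq _ _ hy (hy.trans hz')] at h'
      exact hm3 _ _ _ h h'
    · obtain ⟨z, hz⟩ := hm4 y hy hyW
      exact ⟨z, (hq _ _ hy (hy.trans (hm1 _ _ hz).reachable)).2 hz⟩
  obtain ⟨e, he⟩ := exists_surjective_nat (Finset (ℕ × ℕ))
  have hex' : ∀ x, ∃ k, good x (e k) := by
    intro x
    obtain ⟨q, hq⟩ := hex x
    obtain ⟨k, rfl⟩ := he q
    exact ⟨k, hq⟩
  let κ : X → ℕ := fun x => Nat.find (hex' x)
  have hκ : Measurable κ := measurable_find hex' fun k => hgood (e k)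
  have hκg : ∀ x, good x (e (κ x)) := fun x => Nat.find_spec (hex' x)
  have hgr : ∀ x y, H.Reachable x y → good x = good y := by
    intro x y h
    funext q
    exact propext ⟨fun hx z hz => hx z (h.trans hz), fun hy z hz => hy z (h.symm.trans hz)⟩
  have hκr : ∀ x y, H.Reachable x y → κ x = κ y := by
    intro x y h
    simp only [κ, hgr x y h]
  let M : SimpleGraph X :=
    { Adj := fun x y => L (e (κ x)) x y
      symm := ⟨fun x y h => by
        rw [← hκr x y h.1.reachable]
        exact (hκg x x (.refl _)).1 y h.1.reachable h⟩
      loopless := ⟨fun x h => H.loopless.irrefl x h.1⟩ }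
  refine ⟨M, fun x y h => h.1, ?_, ?_, ?_⟩
  · have : {p : X × X | M.Adj p.1 p.2} = ⋃ k, ({p | κ p.1 = k} ∩ {p | L (e k) p.1 p.2}) := by
      ext p
      simp [M]
    show MeasurableSet {p : X × X | M.Adj p.1 p.2}
    rw [this]
    exact .iUnion fun k => ((hκ.comp measurable_fst) (measurableSet_singleton k)).inter
      (hL _ measurable_fst measurable_snd)
  · intro x y z hy hz
    exact (hκg x x (.refl _)).2.1 y hy.1.reachable z hz.1.reachable hy hz
  · intro x hx
    exact (hκg x x (.refl _)).2.2 hx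

end BorelGraph

/-! ### Distances and generic sparse covers. -/

namespace BorelGraph

/-- `x` and `y` are joined by a walk of length at most `k`. -/
def WithinDist {X : Type*} (G : SimpleGraph X) (k : ℕ) (x y : X) : Prop :=
  ∃ p : G.Walk x y, p.length ≤ k

section WithinDist

variable {X : Type*} {G : SimpleGraph X} {k l : ℕ} {x y z : X}

theorem WithinDist.refl (x : X) : WithinDist G k x x := ⟨.nil, by simp⟩

theorem WithinDist.symm (h : WithinDist G k x y) : WithinDist G k y x := by
  obtain ⟨p, hp⟩ := h
  exact ⟨p.reverse, by simpa using hp⟩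

theorem WithinDist.trans (h : WithinDist G k x y) (h' : WithinDist G l y z) :
    WithinDist G (k + l) x z := by
  obtain ⟨p, hp⟩ := h
  obtain ⟨q, hq⟩ := h'
  exact ⟨p.append q, by rw [SimpleGraph.Walk.length_append]; omega⟩

theorem WithinDist.mono (h : WithinDist G k x y) (hkl : k ≤ l) : WithinDist G l x y := by
  obtain ⟨p, hp⟩ := h
  exact ⟨p, hp.trans hkl⟩

theorem WithinDist.reachable (h : WithinDist G k x y) : G.Reachable x y := by
  obtain ⟨p, -⟩ := h
  exact p.reachable

theorem WithinDist.of_adj (h : G.Adj x y) : WithinDist G 1 x y := ⟨h.toWalk, by simp⟩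

theorem withinDist_zero : WithinDist G 0 x y ↔ x = y := by
  constructor
  · rintro ⟨p, hp⟩
    exact SimpleGraph.Walk.eq_of_length_eq_zero (p := p) (by omega)
  · rintro rfl
    exact .refl _

theorem withinDist_succ :
    WithinDist G (k + 1) x y ↔ ∃ z, WithinDist G k x z ∧ (z = y ∨ G.Adj z y) := by
  constructor
  · rintro ⟨p, hp⟩
    by_cases h : p.length ≤ k
    · exact ⟨y, ⟨p, h⟩, Or.inl rfl⟩
    · have hr : p.reverse.length = k + 1 := by simp; omega
      cases hq : p.reverse with
      | nil => rw [hq] at hr; simp at hr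
      | cons hadj q =>
        rw [hq] at hr
        simp only [SimpleGraph.Walk.length_cons, add_left_inj] at hr
        exact ⟨_, ⟨q.reverse, by simp [hr]⟩, Or.inr hadj.symm⟩
  · rintro ⟨z, hz, rfl | h⟩
    · exact hz.mono (by omega)
    · exact hz.trans (.of_adj h)

theorem finite_withinDist (hf : ∀ x, (G.neighborSet x).Finite) (k : ℕ) (x : X) :
    {y | WithinDist G k x y}.Finite := by
  induction k with
  | zero => simp [withinDist_zero]
  | succ k ih =>
    refine (ih.biUnion fun z _ => (hf z).insert z).subset ?_
    intro y hy
    obtain ⟨z, hz, h⟩ := withinDist_succ.1 hy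
    exact mem_biUnion hz (h.imp (fun h => h.symm) id)

end WithinDist

section Measurable

variable {X : Type*} [MeasurableSpace X] [StandardBorelSpace X]

theorem IsBorel.measurableSet_withinDist {G : SimpleGraph X} (hG : IsBorel G)
    (hc : ∀ x, (G.neighborSet x).Countable) (k : ℕ) :
    MeasurableSet {p : X × X | WithinDist G k p.1 p.2} := by
  induction k with
  | zero =>
    simp only [withinDist_zero]
    exact measurableSet_eq_fun measurable_fst measurable_snd
  | succ k ih =>
    simp only [withinDist_succ]
    refine hG.measurableSet_exists hc measurable_fst
      (Q := fun (p : X × X) z => WithinDist G k p.1 z ∧ (z = p.2 ∨ G.Adj z p.2)) ?_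
      fun p z h => h.1.reachable
    have h1 : Measurable fun q : (X × X) × X => q.1.1 := measurable_fst.comp measurable_fst
    have h2 : Measurable fun q : (X × X) × X => q.1.2 := measurable_snd.comp measurable_fst
    exact ((h1.prodMk measurable_snd) ih).inter ((measurableSet_eq_fun measurable_snd h2).union
      (hG.measurableSet_comp measurable_snd h2))

end Measurable

/-- For a locally finite Borel graph there are Borel sets, the `n`th of which has no two vertices
at distance at most `r n`, which generically cover the space. -/
theorem IsBorel.exists_sparse_cover {X : Type*} [TopologicalSpace X] [PolishSpace X]
    [MeasurableSpace X] [BorelSpace X] {G : SimpleGraph X} (hG : IsBorel G)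
    (hf : ∀ x, (G.neighborSet x).Finite) (r : ℕ → ℕ) :
    ∃ A : ℕ → Set X, (∀ n, MeasurableSet (A n)) ∧
      (∀ n x y, x ∈ A n → y ∈ A n → WithinDist G (r n) x y → x = y) ∧
      IsInvariantComeagreBorel G {x | ∀ y, G.Reachable x y → ∃ n, y ∈ A n} := by
  have hc : ∀ x, (G.neighborSet x).Countable := fun x => (hf x).countable
  choose c hcm hcinj using fun n => hG.exists_labelling hc (hG.measurableSet_withinDist hc (r n))
    (fun x y h => h.reachable) (finite_withinDist hf (r n))
  obtain ⟨a, ha, har⟩ := hG.exists_reachable_enum hc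
  obtain ⟨b, hbc, -, hb⟩ := TopologicalSpace.exists_countable_basis X
  let U : ℕ → Set X := enumerateCountable hbc ∅
  have hUo : ∀ l, IsOpen (U l) := by
    intro l
    rcases range_enumerateCountable_subset hbc ∅ (mem_range_self l) with h | h
    · simp only [U, h, isOpen_empty]
    · exact hb.isOpen h
  -- With `n` coding the pair `(k, l)`, countably many label classes cover the nonempty open set `U
  -- l`, so by Baire one of them has a preimage under `a k` that is nonmeagre in `U l`.
  have hex : ∀ n, ∃ v, (U (Nat.unpair n).2).Nonempty →
      ¬ IsMeagre ({x | c n (a (Nat.unpair n).1 x) = v} ∩ U (Nat.unpair n).2) := by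
    intro n
    by_cases hne : (U (Nat.unpair n).2).Nonempty
    · by_contra! hcon
      refine not_isMeagre_of_isOpen (hUo _) hne ?_
      refine (isMeagre_iUnion fun v => (hcon v).2).mono fun x hx => ?_
      exact mem_iUnion.2 ⟨c n (a (Nat.unpair n).1 x), rfl, hx⟩
    · exact ⟨0, fun h => absurd h hne⟩
  choose α hα using hex
  let A : ℕ → Set X := fun n => {x | c n x = α n}
  have hA : ∀ n, MeasurableSet (A n) := fun n => hcm n (measurableSet_singleton _)
  have hV : ∀ k, a k ⁻¹' (⋃ n, A n) ∈ residual X := by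
    intro k
    have hm : MeasurableSet (a k ⁻¹' (⋃ n, A n)) := ha k (.iUnion hA)
    -- By the Baire property, a nonmeagre set of uncovered points would be comeagre in some `U l`,
    -- against the choice of `α (Nat.pair k l)`.
    obtain ⟨O, hO, hVO⟩ := hm.compl.residualEq_isOpen
    have hmeag : IsMeagre (a k ⁻¹' (⋃ n, A n) ∩ O) := by
      filter_upwards [hVO.mem_iff] with x hx
      rintro ⟨h1, h2⟩
      exact hx.2 h2 h1
    rcases O.eq_empty_or_nonempty with rfl | ⟨x, hx⟩
    · filter_upwards [hVO.mem_iff] with x hx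
      by_contra h
      exact hx.1 h
    · obtain ⟨W, hW, hxW, hWO⟩ := hb.exists_subset_of_mem_open hx hO
      obtain ⟨l, rfl⟩ := subset_range_enumerate hbc ∅ hW
      have := hα (Nat.pair k l)
      simp only [Nat.unpair_pair] at this
      refine absurd (hmeag.mono ?_) (this ⟨x, hxW⟩)
      exact fun y hy => ⟨mem_iUnion.2 ⟨_, hy.1⟩, hWO hy.2⟩
  have hC : {x | ∀ y, G.Reachable x y → ∃ n, y ∈ A n} = ⋂ k, a k ⁻¹' (⋃ n, A n) := by
    ext x
    simp only [mem_ofPred_eq, har, mem_iInter, mem_preimage, mem_iUnion]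
    exact ⟨fun h k => h _ ⟨k, rfl⟩, by rintro h _ ⟨k, rfl⟩; exact h k⟩
  refine ⟨A, hA, fun n x y hx hy hxy => hcinj n x y hxy (hx.trans hy.symm), ?_, ?_, ?_⟩
  · rw [hC]
    exact .iInter fun k => ha k (.iUnion hA)
  · rw [hC]
    exact countable_iInter_mem.2 hV
  · exact fun x y hxy hx z hz => hx z (hxy.reachable.trans hz)

end BorelGraph

/-! ### The toast: nested or separated finite pieces. -/

namespace BorelGraph

/-- Bounds for the radii of the pieces of a toast with separation `R`. -/
def toastRadius (R : ℕ) : ℕ → ℕ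
  | 0 => 0
  | n + 1 => 4 * toastRadius R n + 2 * R

/-- `toastPiece G A R n a x` means that `x` lies in the piece of level `n` around `a`: starting
from `a`, one absorbs the `R`-neighbourhoods of the nearby pieces of the levels `n - 1, …, 0`
around the vertices of `A (n - 1), …, A 0`. -/
def toastPiece {X : Type*} (G : SimpleGraph X) (A : ℕ → Set X) (R : ℕ) : ℕ → X → X → Prop
  | 0, a, x => a = x
  | n + 1, a, x => ∃ s, (s = a ∨ ∃ b, (b ∈ A n ∧ WithinDist G (2 * toastRadius R n + R) a b) ∧
      ∃ y, toastPiece G A R n b y ∧ WithinDist G R y s) ∧ toastPiece G A R n s x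

/-- The outer boundary, of width two, of a piece of level `n`. -/
def toastBoundary {X : Type*} (G : SimpleGraph X) (A : ℕ → Set X) (R : ℕ) (n : ℕ) (b x : X) :
    Prop :=
  b ∈ A n ∧ ¬ toastPiece G A R n b x ∧ ∃ y, toastPiece G A R n b y ∧ WithinDist G 2 y x

section Combinatorics

variable {X : Type*} {G : SimpleGraph X} {A : ℕ → Set X} {R : ℕ}

theorem toastPiece_self (n : ℕ) (a : X) : toastPiece G A R n a a := by
  induction n with
  | zero => rfl
  | succ n ih => exact ⟨a, Or.inl rfl, ih⟩

theorem toastPiece.withinDist {n : ℕ} {a x : X} (h : toastPiece G A R n a x) :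
    WithinDist G (toastRadius R n) a x := by
  induction n generalizing a x with
  | zero => exact withinDist_zero.2 h
  | succ n ih =>
    obtain ⟨s, rfl | ⟨b, ⟨-, hab⟩, y, hby, hys⟩, hsx⟩ := h
    · exact (ih hsx).mono (by simp only [toastRadius]; omega)
    -- The path from `a` through `b`, `y` and `s` to `x` has length at most `(2r + R) + r + R + r`,
    -- where `r` is the radius of level `n`; this is the recursion for `toastRadius`.
    · exact (((hab.trans (ih hby)).trans hys).trans (ih hsx)).mono
        (by simp only [toastRadius]; omega)

/-- A piece contains the `R`-neighbourhood of any piece of a lower level, or is far from it. -/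
theorem toastPiece_subset_or_separated
    (hA : ∀ n x y, x ∈ A n → y ∈ A n → WithinDist G (3 * toastRadius R n + 2 * R) x y → x = y)
    {m n : ℕ} (hmn : m < n) {b : X} (hb : b ∈ A m) (a : X) :
    (∀ y x, toastPiece G A R m b y → WithinDist G R y x → toastPiece G A R n a x) ∨
      ∀ y x, toastPiece G A R m b y → WithinDist G R y x → ¬ toastPiece G A R n a x := by
  induction n, hmn using Nat.le_induction generalizing a with
  | base =>
    by_cases hab : WithinDist G (2 * toastRadius R m + R) a b
    · exact Or.inl fun y x hy hyx => ⟨x, Or.inr ⟨b, ⟨hb, hab⟩, y, hy, hyx⟩, toastPiece_self m x⟩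
    · right
      rintro y x hy hyx ⟨s, hs, hsx⟩
      have hsb : WithinDist G (2 * toastRadius R m + R) s b :=
        ((hsx.withinDist.trans hyx.symm).trans hy.withinDist.symm).mono (by omega)
      rcases hs with rfl | ⟨b', ⟨hb', hab'⟩, y', hy', hys'⟩
      · exact hab hsb
      -- Both centres lie in `A m` at distance at most `3r + 2R`, where `r` is the radius of level
      -- `m`, so sparseness identifies them.
      · have : b' = b := hA m b' b hb' hb
          (((hy'.withinDist.trans hys').trans hsb).mono (by omega))
        exact hab (this ▸ hab')
  | succ n hmn ih =>
    -- A piece of level `n + 1` is a union of pieces of level `n`, for each of which the dichotomy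
    -- is known. This is why pieces are defined around arbitrary vertices.
    by_cases hex : ∃ s, (s = a ∨ ∃ b, (b ∈ A n ∧ WithinDist G (2 * toastRadius R n + R) a b) ∧
        ∃ y, toastPiece G A R n b y ∧ WithinDist G R y s) ∧
        ∀ y x, toastPiece G A R m b y → WithinDist G R y x → toastPiece G A R n s x
    · obtain ⟨s, hs, h⟩ := hex
      exact Or.inl fun y x hy hyx => ⟨s, hs, h y x hy hyx⟩
    · right
      rintro y x hy hyx ⟨s, hs, hsx⟩
      rcases ih s with h | h
      · exact hex ⟨s, hs, h⟩
      · exact h y x hy hyx hsx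

/-- If the larger piece swallows the `R`-neighbourhood of the smaller one, it swallows `p`, which
lies outside it. Otherwise it misses that neighbourhood, yet has a point within `2 + D + 2` of the
smaller piece. -/
theorem toastBoundary_separated_of_lt {D : ℕ} (hD : D + 4 ≤ R)
    (hA : ∀ n x y, x ∈ A n → y ∈ A n → WithinDist G (3 * toastRadius R n + 2 * R) x y → x = y)
    {m n : ℕ} (hmn : m < n) {b b' p q : X} (hp : toastBoundary G A R n b p)
    (hq : toastBoundary G A R m b' q) : ¬ WithinDist G D p q := by
  intro hpq
  obtain ⟨-, hp1, y, hy, hyp⟩ := hp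
  obtain ⟨hb', -, z, hz, hzq⟩ := hq
  rcases toastPiece_subset_or_separated hA hmn hb' b with h | h
  · exact hp1 (h z p hz ((hzq.trans hpq.symm).mono (by omega)))
  · exact h z y hz (((hzq.trans hpq.symm).trans hyp.symm).mono (by omega)) hy

/-- Nearby boundary points belong to the boundary of the same piece. -/
theorem toastBoundary_eq_of_withinDist {D : ℕ} (hD : D + 4 ≤ R)
    (hA : ∀ n x y, x ∈ A n → y ∈ A n → WithinDist G (3 * toastRadius R n + 2 * R) x y → x = y)
    {m n : ℕ} {b b' p q : X} (hp : toastBoundary G A R n b p) (hq : toastBoundary G A R m b' q)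
    (hpq : WithinDist G D p q) : n = m ∧ b = b' := by
  rcases lt_trichotomy m n with h | rfl | h
  · exact absurd hpq (toastBoundary_separated_of_lt hD hA h hp hq)
  · refine ⟨rfl, ?_⟩
    obtain ⟨hb, -, y, hy, hyp⟩ := hp
    obtain ⟨hb', -, z, hz, hzq⟩ := hq
    exact hA m b b' hb hb' (((((hy.withinDist.trans hyp).trans hpq).trans hzq.symm).trans
      hz.withinDist.symm).mono (by omega))
  · exact absurd hpq.symm (toastBoundary_separated_of_lt hD hA h hq hp)

/-- Off the boundaries of the pieces, the components are finite. -/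
theorem finite_component_off_toastBoundary (hf : ∀ x, (G.neighborSet x).Finite)
    (hcov : ∀ x, ∃ n, x ∈ A n) {H : SimpleGraph X} (hHG : H ≤ G)
    (hH : ∀ x y, H.Adj x y → ¬ (∃ n b, toastBoundary G A R n b x) ∨
      ¬ ∃ n b, toastBoundary G A R n b y) (x : X) :
    {y | H.Reachable x y}.Finite := by
  have key : ∀ x, (¬ ∃ n b, toastBoundary G A R n b x) → {y | H.Reachable x y}.Finite := by
    intro x hx
    obtain ⟨n, hn⟩ := hcov x
    refine (finite_withinDist hf (toastRadius R n + 1) x).subset fun y hy => ?_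
    suffices h : toastPiece G A R n x y ∨
        (¬ toastPiece G A R n x y ∧ ∃ z, toastPiece G A R n x z ∧ G.Adj z y) by
      rcases h with h | ⟨-, z, hz, hzy⟩
      · exact h.withinDist.mono (by omega)
      · exact hz.withinDist.trans (.of_adj hzy)
    replace hy : H.Reachable x y := hy
    rw [SimpleGraph.reachable_iff_reflTransGen] at hy
    induction hy with
    | refl => exact Or.inl (toastPiece_self n x)
    | @tail y w _ hyw ih =>
      by_cases hw : toastPiece G A R n x w
      · exact Or.inl hw
      · refine Or.inr ⟨hw, ?_⟩
        rcases ih with hy | ⟨hy, z, hz, hzy⟩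
        · exact ⟨y, hy, hHG hyw⟩
        -- Two successive steps outside the piece would use an edge with both endpoints in the
        -- boundary, since the boundary has width two; such edges are not in `H`.
        · have hyB : toastBoundary G A R n x y := ⟨hn, hy, z, hz, (WithinDist.of_adj hzy).mono (by omega)⟩
          have hwB : toastBoundary G A R n x w :=
            ⟨hn, hw, z, hz, (WithinDist.of_adj hzy).trans (.of_adj (hHG hyw))⟩
          rcases hH y w hyw with h | h
          · exact absurd ⟨n, x, hyB⟩ h
          · exact absurd ⟨n, x, hwB⟩ h
  by_cases hx : ∃ y, H.Adj x y
  · obtain ⟨y, hxy⟩ := hx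
    rcases hH x y hxy with h | h
    · exact key x h
    · exact (key y h).subset fun z hz => hxy.reachable.symm.trans hz
  · refine (finite_singleton x).subset fun y hy => ?_
    replace hy : H.Reachable x y := hy
    rw [SimpleGraph.reachable_iff_reflTransGen] at hy
    rcases hy.cases_head with h | ⟨z, hz, -⟩
    · exact h.symm
    · exact absurd ⟨z, hz⟩ hx

/-- Near the boundaries of the pieces, the components are finite. -/
theorem finite_component_near_toastBoundary (hf : ∀ x, (G.neighborSet x).Finite) {k : ℕ}
    (hk : 2 * k + 7 ≤ R)
    (hA : ∀ n x y, x ∈ A n → y ∈ A n → WithinDist G (3 * toastRadius R n + 2 * R) x y → x = y)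
    {H : SimpleGraph X} (hHG : H ≤ G)
    (hH : ∀ x y, H.Adj x y → (∃ p, (∃ n b, toastBoundary G A R n b p) ∧ WithinDist G k p x) ∨
      ∃ p, (∃ n b, toastBoundary G A R n b p) ∧ WithinDist G k p y) (x : X) :
    {y | H.Reachable x y}.Finite := by
  have hnear : ∀ y z, H.Adj y z → ∃ n b p, toastBoundary G A R n b p ∧ WithinDist G (k + 1) p z := by
    intro y z h
    rcases hH y z h with ⟨p, ⟨n, b, hp⟩, hpy⟩ | ⟨p, ⟨n, b, hp⟩, hpz⟩
    · exact ⟨n, b, p, hp, hpy.trans (.of_adj (hHG h))⟩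
    · exact ⟨n, b, p, hp, hpz.mono (by omega)⟩
  by_cases hx : ∃ y, H.Adj x y
  · obtain ⟨y, hxy⟩ := hx
    obtain ⟨n, b, p, hp, hpx⟩ := hnear y x hxy.symm
    refine (finite_withinDist hf (toastRadius R n + 2 + (k + 1)) b).subset fun y hy => ?_
    suffices h : ∃ q, toastBoundary G A R n b q ∧ WithinDist G (k + 1) q y by
      obtain ⟨q, ⟨-, -, z, hz, hzq⟩, hqy⟩ := h
      exact (hz.withinDist.trans hzq).trans hqy
    replace hy : H.Reachable x y := hy
    rw [SimpleGraph.reachable_iff_reflTransGen] at hy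
    induction hy with
    | refl => exact ⟨p, hp, hpx⟩
    | tail _ hyw ih =>
      obtain ⟨q, hq, hqy⟩ := ih
      obtain ⟨m, b', q', hq', hqw⟩ := hnear _ _ hyw
      -- Adjacent vertices have boundary points within `(k + 1) + 1 + (k + 1)` of each other, so the
      -- whole component stays near the boundary of one piece.
      obtain ⟨rfl, rfl⟩ := toastBoundary_eq_of_withinDist (D := 2 * k + 3) (by omega) hA hq hq'
        (((hqy.trans (.of_adj (hHG hyw))).trans hqw.symm).mono (by omega))
      exact ⟨q', hq', hqw⟩
  · refine (finite_singleton x).subset fun y hy => ?_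
    replace hy : H.Reachable x y := hy
    rw [SimpleGraph.reachable_iff_reflTransGen] at hy
    rcases hy.cases_head with h | ⟨z, hz, -⟩
    · exact h.symm
    · exact absurd ⟨z, hz⟩ hx

end Combinatorics

variable {X : Type*} [MeasurableSpace X] [StandardBorelSpace X]

theorem IsBorel.measurableSet_toastPiece {G : SimpleGraph X} (hG : IsBorel G)
    (hc : ∀ x, (G.neighborSet x).Countable) {A : ℕ → Set X} (hA : ∀ n, MeasurableSet (A n))
    (R n : ℕ) : MeasurableSet {p : X × X | toastPiece G A R n p.1 p.2} := by
  induction n with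
  | zero => exact measurableSet_eq_fun measurable_fst measurable_snd
  | succ n ih =>
    have h1 : MeasurableSet {p : X × X | ∃ y, toastPiece G A R n p.1 y ∧ WithinDist G R y p.2} :=
      hG.measurableSet_exists hc measurable_fst
        (Q := fun (p : X × X) y => toastPiece G A R n p.1 y ∧ WithinDist G R y p.2)
        ((((measurable_fst.comp measurable_fst).prodMk measurable_snd) ih).inter
          ((measurable_snd.prodMk (measurable_snd.comp measurable_fst))
            (hG.measurableSet_withinDist hc R)))
        fun p y h => h.1.withinDist.reachable
    have h2 : MeasurableSet {p : X × X | p.2 = p.1 ∨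
        ∃ b, (b ∈ A n ∧ WithinDist G (2 * toastRadius R n + R) p.1 b) ∧
        ∃ y, toastPiece G A R n b y ∧ WithinDist G R y p.2} := by
      refine (measurableSet_eq_fun measurable_snd measurable_fst).union
        (hG.measurableSet_exists hc measurable_fst (Q := fun (p : X × X) b =>
          (b ∈ A n ∧ WithinDist G (2 * toastRadius R n + R) p.1 b) ∧
          ∃ y, toastPiece G A R n b y ∧ WithinDist G R y p.2) ?_ fun p b h => h.1.2.reachable)
      refine ((measurable_snd (hA n)).inter
        (((measurable_fst.comp measurable_fst).prodMk measurable_snd)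
          (hG.measurableSet_withinDist hc _))).inter ?_
      exact (measurable_snd.prodMk (measurable_snd.comp measurable_fst)) h1
    refine hG.measurableSet_exists hc measurable_fst (Q := fun (p : X × X) s => (s = p.1 ∨
        ∃ b, (b ∈ A n ∧ WithinDist G (2 * toastRadius R n + R) p.1 b) ∧
        ∃ y, toastPiece G A R n b y ∧ WithinDist G R y s) ∧ toastPiece G A R n s p.2) ?_ ?_
    · exact (((measurable_fst.comp measurable_fst).prodMk measurable_snd) h2).inter
        ((measurable_snd.prodMk (measurable_snd.comp measurable_fst)) ih)
    · rintro p s ⟨rfl | ⟨b, ⟨-, hb⟩, y, hy, hys⟩, -⟩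
      · exact .refl _
      · exact hb.reachable.trans (hy.withinDist.reachable.trans hys.reachable)

theorem IsBorel.measurableSet_toastBoundary {G : SimpleGraph X} (hG : IsBorel G)
    (hc : ∀ x, (G.neighborSet x).Countable) {A : ℕ → Set X} (hA : ∀ n, MeasurableSet (A n))
    (R : ℕ) : MeasurableSet {x | ∃ n b, toastBoundary G A R n b x} := by
  have : {x | ∃ n b, toastBoundary G A R n b x} = ⋃ n, {x | ∃ b, toastBoundary G A R n b x} := by
    ext x
    simp
  rw [this]
  refine .iUnion fun n => hG.measurableSet_exists hc measurable_id
    (Q := fun x b => toastBoundary G A R n b x) ?_ ?_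
  · have hp := hG.measurableSet_toastPiece hc hA R n
    refine (measurable_snd (hA n)).inter (.inter (measurable_swap hp).compl ?_)
    refine hG.measurableSet_exists hc measurable_snd (Q := fun (q : X × X) y =>
      toastPiece G A R n q.2 y ∧ WithinDist G 2 y q.1) ?_ fun q y h => h.1.withinDist.reachable
    exact (((measurable_snd.comp measurable_fst).prodMk measurable_snd) hp).inter
      ((measurable_snd.prodMk (measurable_fst.comp measurable_fst))
        (hG.measurableSet_withinDist hc 2))
  · rintro x b ⟨-, -, y, hy, hyx⟩
    exact (hy.withinDist.reachable.trans hyx.reachable).symm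

end BorelGraph

/-! ### Removing matchings one at a time. -/

namespace BorelGraph

universe u

/-- The edges of `G` with at least one endpoint in `S`. -/
def edgesMeeting {X : Type*} (G : SimpleGraph X) (S : Set X) : SimpleGraph X where
  Adj x y := G.Adj x y ∧ (x ∈ S ∨ y ∈ S)
  symm := ⟨fun _ _ h => ⟨h.1.symm, h.2.symm⟩⟩
  loopless := ⟨fun x h => G.loopless.irrefl x h.1⟩

theorem ncard_neighborSet_mono {X : Type*} {G H : SimpleGraph X} (h : H ≤ G) {x : X}
    (hf : (G.neighborSet x).Finite) : (H.neighborSet x).ncard ≤ (G.neighborSet x).ncard :=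
  ncard_le_ncard (fun _ hy => h hy) hf

theorem ncard_neighborSet_sdiff_lt {X : Type*} {G M : SimpleGraph X} {x y : X} (hM : M ≤ G)
    (hxy : M.Adj x y) (hf : (G.neighborSet x).Finite) :
    ((G \ M).neighborSet x).ncard < (G.neighborSet x).ncard := by
  refine ncard_lt_ncard ⟨fun z hz => hz.1, fun h => ?_⟩ hf
  exact (h (hM hxy)).2 hxy

section Measurable

variable {X : Type*} [MeasurableSpace X]

theorem IsBorel.edgesMeeting {G : SimpleGraph X} (hG : IsBorel G) {S : Set X}
    (hS : MeasurableSet S) : IsBorel (edgesMeeting G S) :=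
  .inter hG (.union (measurable_fst hS) (measurable_snd hS))

theorem IsBorel.sdiff {G M : SimpleGraph X} (hG : IsBorel G) (hM : IsBorel M) :
    IsBorel (G \ M) :=
  MeasurableSet.inter hG (MeasurableSet.compl hM)

theorem IsBorel.sup {G M : SimpleGraph X} (hG : IsBorel G) (hM : IsBorel M) :
    IsBorel (G ⊔ M) :=
  MeasurableSet.union hG hM

variable [StandardBorelSpace X]

/-- If the edges meeting `Z` and the edges meeting the complement of `Z'` have finite components,
where `Z'` contains the `2`-neighbourhood of `Z`, then some Borel matching can be removed so as to
lower the bounds on the degrees by one, in exchange for enlarging `Z` to `Z'`. -/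
theorem IsBorel.exists_matching_lowering_degree {G : SimpleGraph X} (hG : IsBorel G)
    (hbip : G.IsBipartite) (hf : ∀ x, (G.neighborSet x).Finite) {Z Z' : Set X}
    (hZ : MeasurableSet Z) (hZ' : MeasurableSet Z')
    (hZZ' : ∀ x y, x ∈ Z → WithinDist G 2 x y → y ∈ Z')
    (hfin : ∀ x, {y | (BorelGraph.edgesMeeting G Z).Reachable x y}.Finite)
    (hfin' : ∀ x, {y | (BorelGraph.edgesMeeting G Z'ᶜ).Reachable x y}.Finite) {D : ℕ} (hD : 0 < D)
    (hdeg : ∀ x, (G.neighborSet x).ncard ≤ D + 1)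
    (hdeg' : ∀ x, x ∉ Z → (G.neighborSet x).ncard ≤ D) :
    ∃ M ≤ G, IsBorel M ∧ IsMatchingGraph M ∧ (∀ x, ((G \ M).neighborSet x).ncard ≤ D) ∧
      ∀ x, x ∉ Z' → ((G \ M).neighborSet x).ncard + 1 ≤ D := by
  have hle : ∀ S, BorelGraph.edgesMeeting G S ≤ G := fun S x y h => h.1
  have hsub : ∀ x, x ∈ Z → x ∈ Z' := fun x hx => hZZ' x x hx (.refl _)
  have hsub1 : ∀ x y, x ∈ Z → G.Adj x y → y ∈ Z' := fun x y hx hxy =>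
    hZZ' x y hx ((WithinDist.of_adj hxy).mono (by omega))
  have hnb : ∀ (S : Set X) x, x ∈ S → (BorelGraph.edgesMeeting G S).neighborSet x =
      G.neighborSet x := by
    intro S x hx
    ext y
    exact ⟨fun h => h.1, fun h => ⟨h, Or.inl hx⟩⟩
  obtain ⟨M₁, hM₁, hM₁b, hM₁m, hM₁c⟩ := (hG.edgesMeeting hZ).exists_matching_covering
    (hbip.mono_left (hle Z)) hfin (Nat.succ_pos D)
    (fun x => (ncard_neighborSet_mono (hle Z) (hf x)).trans (hdeg x))
  obtain ⟨M₂, hM₂, hM₂b, hM₂m, hM₂c⟩ := (hG.edgesMeeting hZ'.compl).exists_matching_covering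
    (hbip.mono_left (hle Z'ᶜ)) hfin' hD (by
      intro x
      by_cases hx : x ∈ Z
      -- Vertices of `Z`, the only ones that may have degree `D + 1`, are isolated in this graph, so
      -- its degrees are at most `D`.
      · have : (BorelGraph.edgesMeeting G Z'ᶜ).neighborSet x = ∅ := by
          rw [eq_empty_iff_forall_notMem]
          rintro y ⟨hxy, h | h⟩
          · exact h (hsub x hx)
          · exact h (hsub1 x y hx hxy)
        simp [this]
      · exact (ncard_neighborSet_mono (hle _) (hf x)).trans (hdeg' x hx))
  -- Every vertex of an edge meeting `Z` is within distance one of `Z`, and so are its neighbours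
  -- within distance two, hence in `Z'`.
  have hdisj : ∀ x y z, M₁.Adj x y → M₂.Adj x z → False := by
    intro x y z hy hz
    obtain ⟨hxy, hy⟩ := hM₁ hy
    obtain ⟨hxz, hz⟩ := hM₂ hz
    rcases hy with hx | hy
    · exact hz.elim (fun h => h (hsub x hx)) fun h => h (hsub1 x z hx hxz)
    · exact hz.elim (fun h => h (hsub1 y x hy hxy.symm)) fun h =>
        h (hZZ' y z hy ((WithinDist.of_adj hxy.symm).trans (.of_adj hxz)))
  have hMG : M₁ ⊔ M₂ ≤ G := sup_le (hM₁.trans (hle _)) (hM₂.trans (hle _))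
  refine ⟨M₁ ⊔ M₂, hMG, hM₁b.sup hM₂b, ?_, ?_, ?_⟩
  · rintro x y z (hy | hy) (hz | hz)
    · exact hM₁m hy hz
    · exact (hdisj x y z hy hz).elim
    · exact (hdisj x z y hz hy).elim
    · exact hM₂m hy hz
  · intro x
    by_cases hx : (G.neighborSet x).ncard ≤ D
    · exact (ncard_neighborSet_mono sdiff_le (hf x)).trans hx
    · have hxZ : x ∈ Z := by
        by_contra h
        exact hx (hdeg' x h)
      obtain ⟨y, hy⟩ := hM₁c x (by
        rw [hnb Z x hxZ]
        exact le_antisymm (hdeg x) (not_le.1 hx))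
      have := ncard_neighborSet_sdiff_lt hMG (Or.inl hy) (hf x)
      have := hdeg x
      omega
  · intro x hx
    have hxD := hdeg' x fun h => hx (hsub x h)
    by_cases hxe : (G.neighborSet x).ncard = D
    · obtain ⟨y, hy⟩ := hM₂c x (by rwa [hnb Z'ᶜ x hx])
      have := ncard_neighborSet_sdiff_lt hMG (Or.inr hy) (hf x)
      omega
    · have : ((G \ (M₁ ⊔ M₂)).neighborSet x).ncard ≤ (G.neighborSet x).ncard :=
        ncard_neighborSet_mono sdiff_le (hf x)
      omega

/-- A Borel bipartite graph of maximum degree at most `Δ` which is covered by sufficiently sparse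
Borel sets of vertices is a union of `Δ + 1` Borel matchings. -/
theorem IsBorel.exists_matchings_of_sparse_cover {G : SimpleGraph X} (hG : IsBorel G)
    (hbip : G.IsBipartite) (hf : ∀ x, (G.neighborSet x).Finite) {Δ : ℕ}
    (hdeg : ∀ x, (G.neighborSet x).ncard ≤ Δ) {A : ℕ → Set X} (hAm : ∀ n, MeasurableSet (A n))
    (hA : ∀ n x y, x ∈ A n → y ∈ A n →
      WithinDist G (3 * toastRadius (4 * Δ + 7) n + 2 * (4 * Δ + 7)) x y → x = y)
    (hcov : ∀ x, ∃ n, x ∈ A n) :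
    ∃ M : ℕ → SimpleGraph X, (∀ i, IsBorel (M i) ∧ IsMatchingGraph (M i)) ∧
      ∀ x y, G.Adj x y → ∃ i < Δ + 1, (M i).Adj x y := by
  have hc : ∀ x, (G.neighborSet x).Countable := fun x => (hf x).countable
  -- Separation `4 * Δ + 7` is enough: round `j < Δ` uses the neighbourhood of radius `k = 2 * j`,
  -- which requires `2 * k + 7 ≤ R`.
  set B : Set X := {x | ∃ n b, toastBoundary G A (4 * Δ + 7) n b x} with hB
  have hBm : MeasurableSet B := hG.measurableSet_toastBoundary hc hAm _
  let Z : ℕ → Set X := fun j => {x | ∃ p, p ∈ B ∧ WithinDist G (2 * j) p x}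
  have hZm : ∀ j, MeasurableSet (Z j) := fun j =>
    hG.measurableSet_exists hc measurable_id
      (Q := fun x p => p ∈ B ∧ WithinDist G (2 * j) p x)
      ((measurable_snd hBm).inter (measurable_swap (hG.measurableSet_withinDist hc _)))
      fun x p h => h.2.reachable.symm
  have main : ∀ j ≤ Δ, ∃ G' ≤ G, IsBorel G' ∧ (∀ x, (G'.neighborSet x).ncard + j ≤ Δ + 1) ∧
      (∀ x, x ∉ Z j → (G'.neighborSet x).ncard + j ≤ Δ) ∧
      ∃ M : ℕ → SimpleGraph X, (∀ i, IsBorel (M i) ∧ IsMatchingGraph (M i)) ∧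
        ∀ x y, G.Adj x y → G'.Adj x y ∨ ∃ i < j, (M i).Adj x y := by
    intro j
    induction j with
    | zero =>
      intro _
      refine ⟨G, le_rfl, hG, fun x => (hdeg x).trans (by omega), fun x _ => hdeg x,
        fun _ => ⊥, fun _ => ⟨?_, fun x y z h => h.elim⟩, fun x y h => Or.inl h⟩
      simp [IsBorel]
    | succ j ih =>
      intro hj
      obtain ⟨G', hG'G, hG', hd1, hd2, M, hM, hMcov⟩ := ih (by omega)
      obtain ⟨D, rfl⟩ : ∃ D, Δ = D + j := ⟨Δ - j, by omega⟩
      have hf' : ∀ x, (G'.neighborSet x).Finite := fun x => (hf x).subset fun y h => hG'G h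
      have hfin : ∀ x, {y | (BorelGraph.edgesMeeting G' (Z j)).Reachable x y}.Finite :=
        finite_component_near_toastBoundary (k := 2 * j) hf (by omega) hA
          (fun x y h => hG'G h.1) (fun x y h => h.2)
      have hfin' : ∀ x, {y | (BorelGraph.edgesMeeting G' (Z (j + 1))ᶜ).Reachable x y}.Finite :=
        finite_component_off_toastBoundary hf hcov (fun x y h => hG'G h.1)
          (fun x y h => h.2.imp (fun h hx => h ⟨x, hx, .refl _⟩) fun h hy => h ⟨y, hy, .refl _⟩)
      obtain ⟨N, hNG, hNb, hNm, hN1, hN2⟩ := hG'.exists_matching_lowering_degree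
        (hbip.mono_left hG'G) hf' (hZm j) (hZm (j + 1)) (by
          rintro x y ⟨p, hp, hpx⟩ ⟨w, hw⟩
          refine ⟨p, hp, hpx.trans ⟨w.mapLe hG'G, ?_⟩⟩
          simpa using hw) hfin hfin' (D := D) (by omega)
        (fun x => by have := hd1 x; omega) (fun x hx => by have := hd2 x hx; omega)
      refine ⟨G' \ N, sdiff_le.trans hG'G, hG'.sdiff hNb, fun x => by have := hN1 x; omega,
        fun x hx => by have := hN2 x hx; omega, Function.update M j N, fun i => ?_, ?_⟩
      · by_cases hi : i = j
        · subst hi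
          simpa using ⟨hNb, hNm⟩
        · simpa [hi] using hM i
      · intro x y hxy
        by_cases hN : N.Adj x y
        · exact Or.inr ⟨j, by omega, by simpa using hN⟩
        · rcases hMcov x y hxy with h | ⟨i, hi, h⟩
          · exact Or.inl ⟨h, hN⟩
          · exact Or.inr ⟨i, by omega, by simpa [hi.ne] using h⟩
  obtain ⟨G', hG'G, hG', hd, -, M, hM, hMcov⟩ := main Δ le_rfl
  -- After `Δ` rounds the degrees are at most one, and the remainder is the last matching.
  have hm : IsMatchingGraph G' := by
    intro x y z hy hz
    have hx : (G'.neighborSet x).ncard ≤ 1 := by have := hd x; omega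
    exact (ncard_le_one ((hf x).subset fun y h => hG'G h)).1 hx y hy z hz
  refine ⟨Function.update M Δ G', fun i => ?_, fun x y hxy => ?_⟩
  · by_cases hi : i = Δ
    · subst hi
      simpa using ⟨hG', hm⟩
    · simpa [hi] using hM i
  · rcases hMcov x y hxy with h | ⟨i, hi, h⟩
    · exact ⟨Δ, by omega, by simpa using h⟩
    · exact ⟨i, by omega, by simpa [hi.ne] using h⟩

end Measurable

/-! ### From matchings to colourings, and infinite degrees. -/

/-- A graph which is the union of Borel matchings indexed by a countable discrete space has a
Borel edge colouring with the indices as colours. -/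
theorem hasBorelEdgeColoring_of_matchings {X Y : Type u} [MeasurableSpace X] [Countable Y]
    [MeasurableSpace Y] [DiscreteMeasurableSpace Y] {G : SimpleGraph X} (M : Y → SimpleGraph X)
    (hM : ∀ i, IsBorel (M i) ∧ IsMatchingGraph (M i))
    (hcov : ∀ x y, G.Adj x y → ∃ i, (M i).Adj x y) : HasBorelEdgeColoring G #Y := by
  classical
  obtain ⟨f, hf⟩ := Countable.exists_injective_nat Y
  -- Each edge is coloured by the first matching containing it, in an enumeration of the indices.
  have hex : ∀ e : G.edgeSet, ∃ i, (e : Sym2 X) ∈ (M i).edgeSet ∧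
      ∀ j, f j < f i → (e : Sym2 X) ∉ (M j).edgeSet := by
    rintro ⟨e, he⟩
    have hne : ∃ k i, f i = k ∧ e ∈ (M i).edgeSet := by
      induction e with
      | _ x y =>
        obtain ⟨i, hi⟩ := hcov x y he
        exact ⟨f i, i, rfl, hi⟩
    obtain ⟨i, hi, hei⟩ := Nat.find_spec hne
    exact ⟨i, hei, fun j hj h => Nat.find_min hne (hi ▸ hj) ⟨j, rfl, h⟩⟩
  choose c hc1 hc2 using hex
  have hciff : ∀ e i, c e = i ↔ (e : Sym2 X) ∈ (M i).edgeSet ∧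
      ∀ j, f j < f i → (e : Sym2 X) ∉ (M j).edgeSet := by
    intro e i
    constructor
    · rintro rfl
      exact ⟨hc1 e, hc2 e⟩
    · rintro ⟨h1, h2⟩
      rcases lt_trichotomy (f (c e)) (f i) with h | h | h
      · exact absurd (hc1 e) (h2 _ h)
      · exact hf h
      · exact absurd h1 (hc2 e _ h)
  refine ⟨Y, inferInstance, inferInstance, rfl, SimpleGraph.Coloring.mk c ?_, ?_⟩
  · intro e₁ e₂ hadj heq
    obtain ⟨hne, v, hv1, hv2⟩ := SimpleGraph.lineGraph_adj_iff_exists.1 hadj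
    have h1 := hc1 e₁
    have h2 := hc1 e₂
    rw [← heq] at h2
    obtain ⟨a, ha⟩ := hv1
    obtain ⟨b, hb⟩ := hv2
    rw [ha, SimpleGraph.mem_edgeSet] at h1
    rw [hb, SimpleGraph.mem_edgeSet] at h2
    refine hne (Subtype.ext ?_)
    rw [ha, hb, (hM _).2 h1 h2]
  · refine measurable_to_countable' fun i => ?_
    have : (fun p : {p : X × X // G.Adj p.1 p.2} =>
        c ⟨s(p.1.1, p.1.2), G.mem_edgeSet.2 p.2⟩) ⁻¹' {i} =
        Subtype.val ⁻¹' ({p : X × X | (M i).Adj p.1 p.2} ∩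
          ⋂ j, ⋂ (_ : f j < f i), {p : X × X | (M j).Adj p.1 p.2}ᶜ) := by
      ext p
      simp [hciff]
    exact this ▸ measurable_subtype_coe
      ((hM i).1.inter (.iInter fun j => .iInter fun _ => (hM j).1.compl))

/-- Colouring every edge by its ordered pair of endpoints. -/
theorem hasBorelEdgeColoring_prod {X : Type u} [MeasurableSpace X] [StandardBorelSpace X]
    (G : SimpleGraph X) : HasBorelEdgeColoring G #(X × X) := by
  classical
  obtain ⟨φ, hφ⟩ := exists_measurableEmbedding_real X
  -- A Borel linear order, pulled back from the reals, orients each edge.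
  let g : X → X → X × X := fun x y => if φ x ≤ φ y then (x, y) else (y, x)
  have hg : ∀ x y, g x y = g y x := by
    intro x y
    simp only [g]
    split_ifs with h1 h2 h2
    · rw [hφ.injective (le_antisymm h1 h2)]
    · rfl
    · rfl
    · exact absurd (le_total _ _) (not_or.2 ⟨h1, h2⟩)
  have hmk : ∀ x y, s((g x y).1, (g x y).2) = s(x, y) := by
    intro x y
    simp only [g]
    split_ifs
    · rfl
    · exact Sym2.eq_swap
  let c : Sym2 X → X × X := Sym2.lift ⟨g, hg⟩
  have hc : Function.LeftInverse (fun p : X × X => s(p.1, p.2)) c := by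
    intro e
    induction e with
    | _ x y => exact hmk x y
  refine ⟨X × X, inferInstance, inferInstance, rfl,
    SimpleGraph.Coloring.mk (fun e => c e) ?_, ?_⟩
  · intro e₁ e₂ hadj heq
    exact hadj.ne (Subtype.ext (hc.injective heq))
  · have : Measurable fun p : X × X => g p.1 p.2 := by
      refine Measurable.ite ?_ measurable_id measurable_swap
      exact measurableSet_le (hφ.measurable.comp measurable_fst) (hφ.measurable.comp measurable_snd)
    exact this.comp measurable_subtype_coe

section Induce

variable {X : Type u} {G : SimpleGraph X}

theorem IsBorel.induce [MeasurableSpace X] (hG : IsBorel G) (C : Set X) : IsBorel (G.induce C) :=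
  ((measurable_subtype_coe.comp measurable_fst).prodMk
    (measurable_subtype_coe.comp measurable_snd)) hG

theorem ncard_neighborSet_induce_le {C : Set X} (x : C) (hf : (G.neighborSet x).Finite) :
    ((G.induce C).neighborSet x).ncard ≤ (G.neighborSet x).ncard :=
  ncard_le_ncard_of_injOn Subtype.val (fun _ hy => hy) Subtype.val_injective.injOn hf

theorem WithinDist.of_induce {C : Set X} {k : ℕ} {x y : C} (h : WithinDist (G.induce C) k x y) :
    WithinDist G k (x : X) y := by
  obtain ⟨p, hp⟩ := h
  exact ⟨p.map (SimpleGraph.Embedding.induce C).toHom, (SimpleGraph.Walk.length_map _ _).trans_le hp⟩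

theorem isInvariantComeagreBorel_univ [TopologicalSpace X] [MeasurableSpace X] :
    IsInvariantComeagreBorel G univ :=
  ⟨.univ, univ_mem, fun _ _ _ _ => mem_univ _⟩

end Induce

theorem mk_neighborSet_le_maxDegree {X : Type u} (G : SimpleGraph X) (x : X) :
    #(G.neighborSet x) ≤ maxDegree G :=
  le_ciSup (f := fun x => #(G.neighborSet x)) Cardinal.bddAbove_of_small x

/-- If some vertex has uncountably many neighbours, then the maximum degree is the number of
vertices. -/
theorem maxDegree_eq_mk_of_not_countable {X : Type u} [MeasurableSpace X] [StandardBorelSpace X]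
    {G : SimpleGraph X} (hG : IsBorel G) {x : X} (hx : ¬ (G.neighborSet x).Countable) :
    maxDegree G = #X := by
  refine le_antisymm (ciSup_le' fun y => mk_set_le _) ?_
  have hm : MeasurableSet (G.neighborSet x) := hG.measurableSet_comp measurable_const measurable_id
  have := hm.standardBorel
  have h2 : ¬ Countable X := fun h => hx (to_countable _)
  -- The neighbourhood is an uncountable Borel set, so it has as many points as the whole space.
  have e := PolishSpace.measurableEquivOfNotCountable (α := X) (β := G.neighborSet x) h2
    (fun h => hx (countable_coe_iff.1 h))
  rw [mk_congr e.toEquiv]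
  exact mk_neighborSet_le_maxDegree G x

/-- A bipartite Borel graph of maximum degree `Δ` has a Borel edge colouring with `Δ + 1` colours
on an invariant comeagre Borel set. -/
theorem IsBorel.exists_comeagre_hasBorelEdgeColoring {X : Type u} [TopologicalSpace X]
    [PolishSpace X] [MeasurableSpace X] [BorelSpace X] {G : SimpleGraph X} (hG : IsBorel G)
    (hbip : G.IsBipartite) :
    ∃ C : Set X, IsInvariantComeagreBorel G C ∧
      HasBorelEdgeColoring (G.induce C) (maxDegree G + 1) := by
  by_cases hc : ∀ x, (G.neighborSet x).Countable
  · rcases lt_or_ge (maxDegree G) ℵ₀ with hfin | hinf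
    · obtain ⟨Δ, hΔ⟩ := Cardinal.lt_aleph0.1 hfin
      have hle : ∀ x, #(G.neighborSet x) ≤ Δ := fun x => hΔ ▸ mk_neighborSet_le_maxDegree G x
      have hf : ∀ x, (G.neighborSet x).Finite := fun x =>
        lt_aleph0_iff_set_finite.1 ((hle x).trans_lt (natCast_lt_aleph0 (n := Δ)))
      have hdeg : ∀ x, (G.neighborSet x).ncard ≤ Δ := by
        intro x
        have := hle x
        rw [← cast_ncard (hf x)] at this
        exact_mod_cast this
      obtain ⟨A, hAm, hA, hC⟩ := hG.exists_sparse_cover hf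
        (fun n => 3 * toastRadius (4 * Δ + 7) n + 2 * (4 * Δ + 7))
      set C := {x | ∀ y, G.Reachable x y → ∃ n, y ∈ A n}
      refine ⟨C, hC, ?_⟩
      have := hC.measurableSet.standardBorel
      obtain ⟨c⟩ := hbip
      obtain ⟨M, hM, hcov⟩ := (hG.induce C).exists_matchings_of_sparse_cover
        (A := fun n => Subtype.val ⁻¹' A n)
        ⟨c.comp (SimpleGraph.Embedding.induce C).toHom⟩
        (fun x => (hf x).preimage Subtype.val_injective.injOn)
        (fun x => (ncard_neighborSet_induce_le x (hf x)).trans (hdeg x))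
        (fun n => measurable_subtype_coe (hAm n))
        -- Passing to an induced subgraph can only increase distances, so sparseness survives.
        (fun n x y hx hy h => Subtype.ext (hA n x y hx hy h.of_induce))
        (fun x => x.2 x (.refl _))
      have h := hasBorelEdgeColoring_of_matchings (G := G.induce C) (Y := ULift.{u} (Fin (Δ + 1)))
        (fun i => M i.down) (fun i => hM _) (fun x y hxy => by
          obtain ⟨i, hi, h⟩ := hcov x y hxy
          exact ⟨⟨⟨i, hi⟩⟩, h⟩)
      rw [hΔ]
      simpa using h
    · have hle : maxDegree G ≤ ℵ₀ := ciSup_le' fun x => (hc x).le_aleph0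
      have heq : maxDegree G = ℵ₀ := le_antisymm hle hinf
      refine ⟨univ, isInvariantComeagreBorel_univ, ?_⟩
      obtain ⟨M, hM, hcov⟩ := (hG.induce univ).exists_matchings
        (fun x => (hc x).preimage_of_injOn Subtype.val_injective.injOn)
      have h := hasBorelEdgeColoring_of_matchings (G := G.induce univ) (Y := ULift.{u} ℕ)
        (fun i => M i.down) (fun i => hM _) (fun x y hxy => by
          obtain ⟨i, h⟩ := (hcov x y).1 hxy
          exact ⟨⟨i⟩, h⟩)
      rw [heq]
      simpa using h
  · push Not at hc
    obtain ⟨x, hx⟩ := hc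
    refine ⟨univ, isInvariantComeagreBorel_univ, ?_⟩
    have : Infinite X := by
      by_contra h
      rw [not_infinite_iff_finite] at h
      exact hx (to_countable _)
    have h := hasBorelEdgeColoring_prod (G.induce univ)
    have hcard : #(↥(univ : Set X) × ↥(univ : Set X)) = maxDegree G + 1 := by
      rw [maxDegree_eq_mk_of_not_countable hG hx, mk_prod, lift_id, mk_univ,
        mul_eq_self (aleph0_le_mk X), add_one_eq (aleph0_le_mk X)]
    rwa [hcard] at h

end BorelGraph

theorem theorem1 {X : Type*} [TopologicalSpace X] [PolishSpace X] [MeasurableSpace X]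
    [BorelSpace X] (G : SimpleGraph X) (hG : BorelGraph.IsBorel G) (hbip : G.IsBipartite) :
    BorelGraph.baireEdgeChromaticNumber G ≤ BorelGraph.maxDegree G + 1 ∧
      ∃ C : Set X, BorelGraph.IsInvariantComeagreBorel G C ∧
        BorelGraph.HasBorelEdgeColoring (G.induce C) (BorelGraph.maxDegree G + 1) := by
  obtain ⟨C, hC, hcol⟩ := hG.exists_comeagre_hasBorelEdgeColoring hbip
  have h1 : BorelGraph.baireEdgeChromaticNumber G ≤
      BorelGraph.borelEdgeChromaticNumber (G.induce C) := csInf_le' ⟨C, hC, rfl⟩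
  have h2 : BorelGraph.borelEdgeChromaticNumber (G.induce C) ≤ BorelGraph.maxDegree G + 1 :=
    csInf_le' hcol
  exact ⟨h1.trans h2, C, hC, hcol⟩
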